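/- Conventions. A bisimplicial set is a functor $X:\Delta^{\mathrm{op}}\times\Delta^{\mathrm{op}}\to\mathbf{Set}$, $X_{n,m}=X([n],[m])$, with $n$-th column $X_{n,\bullet}$ and $m$-th row $X_{\bullet,m}$; $d_{i,\bullet},s_{i,\bullet}$ denote the face and degeneracy operators in the first variable and $d_{\bullet,i},s_{\bullet,i}$ those in the second. For a simplicial set $K$, $\mathrm{M}_\mathrm{v}(K,X)$ is the simplicial set $m\mapsto\mathrm{Hom}(K,X_{\bullet,m})$, so that $\mathrm{M}_\mathrm{v}(\Delta^n,X)\cong X_{n,\bullet}$. A *Segal space* is a bisimplicial set $X$ that is fibrant in the vertical Reedy model structure, i.e. $\mathrm{M}_\mathrm{v}(\Delta^n,X)\to\mathrm{M}_\mathrm{v}(\partial\Delta^n,X)$ is a Kan fibration for all $n\ge0$, and such that for all $n\ge1$ the map $\mathrm{M}_\mathrm{v}(\Delta^n,X)\to\mathrm{M}_\mathrm{v}(G^n,X)$ is a weak homotopy equivalence, where $G^n\subseteq\Delta^n$ is the spine, i.e. the simplicial subset generated by the edges $i\to i+1$. For vertices $x_0,\dots,x_n$ of $X_{0,\bullet}$,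 let $X(x_0,\dots,x_n)$ be the fibre over $(x_0,\dots,x_n)$ of the map $X_{n,\bullet}\to X_{0,\bullet}\times\cdots\times X_{0,\bullet}$ induced by the vertices of $[n]$. The *homotopy category* $\mathrm{Ho}\,X$ of a Segal space $X$ has as objects the vertices of $X_{0,\bullet}$ and as morphisms $x_0\to x_1$ the connected components of $X(x_0,x_1)$; the identity of $x$ is the component of $s_{0,\bullet}(x)$, and composition is the map $$\pi_0X(x_0,x_1)\times\pi_0X(x_1,x_2)\cong\pi_0X(x_0,x_1,x_2)\to\pi_0X(x_0,x_2),$$ where the bijection is induced by $(d_{2,\bullet},d_{0,\bullet})$ and the second map by $d_{1,\bullet}$. Finally, $\tau_1$ is the left adjoint of the nerve functor from small categories to simplicial sets; the objects of $\tau_1(Y)$ are the vertices of $Y$, and each edge $p$ of $Y$ from $y_0=d_1(p)$ to $y_1=d_0(p)$ gives a morphism $[p]:y_0\to y_1$. Statement. Let $X$ be a Segal space. (1) For each edge $p$ of $X_{0,\bullet}$ there exists an edge $\sigma$ of $X_{1,\bullet}$ satisfying $$d_{1,\bullet}(\sigma)=p,\qquad d_{0,\bullet}(\sigma)=s_{\bullet,0}(d_{\bullet,0}(p)),\qquad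 d_{\bullet,0}(\sigma)=s_{0,\bullet}(d_{\bullet,0}(p)).$$ Call such a $\sigma$ a connection for $p$. If $p$ is an edge from $x_0=d_{\bullet,1}(p)$ to $x_1=d_{\bullet,0}(p)$, then $d_{\bullet,1}(\sigma)$ is a vertex of $X(x_0,x_1)$. (2) The connected component of $d_{\bullet,1}(\sigma)$ depends only on $p$: if $\sigma$ and $\sigma'$ are connections for the same edge $p$ from $x_0$ to $x_1$, then $d_{\bullet,1}(\sigma)$ and $d_{\bullet,1}(\sigma')$ lie in the same connected component of $X_{1,\bullet}$ and, moreover, in the same connected component of $X(x_0,x_1)$. (3) This defines a functor: there is exactly one functor $j_X:\tau_1(X_{0,\bullet})\to\mathrm{Ho}\,X$ that is the identity on objects and sends $[p]$, for each edge $p$ of $X_{0,\bullet}$ from $x_0$ to $x_1$, to the connected component of $d_{\bullet,1}(\sigma)$ in $X(x_0,x_1)$, for every connection $\sigma$ for $p$. -/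

import Mathlib

open CategoryTheory Simplicial Opposite MonoidalCategory HomotopicalAlgebra
universe u

namespace SegalSpaces
open SSet modelCategoryQuillen

/-- Simplicial homotopy of maps of simplicial sets. -/
def HomotopyRel {X Z : SSet.{u}} (f g : X ⟶ Z) : Prop := Nonempty (SSet.Homotopy f g)

lemma homotopyRel_iff {X Z : SSet.{u}} (f g : X ⟶ Z) :
    HomotopyRel f g ↔ ∃ h : X ⊗ Δ[1] ⟶ Z, ι₀ ≫ h = f ∧ ι₁ ≫ h = g := by
  constructor
  · rintro ⟨H⟩
    exact ⟨H.h, H.h₀, H.h₁⟩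
  · rintro ⟨h, h₀, h₁⟩
    refine ⟨⟨h, h₀, h₁, ?_⟩⟩
    ext n ⟨⟨_, hx⟩, _⟩
    exact hx.elim

lemma HomotopyRel.precomp {X Y Z : SSet.{u}} {g h : Y ⟶ Z} (H : HomotopyRel g h) (f : X ⟶ Y) :
    HomotopyRel (f ≫ g) (f ≫ h) := by
  rw [homotopyRel_iff] at H ⊢
  obtain ⟨k, h₀, h₁⟩ := H
  exact ⟨f ▷ _ ≫ k, by rw [ι₀_comp_assoc, h₀], by rw [ι₁_comp_assoc, h₁]⟩

lemma HomotopyRel.postcomp {X Y Z : SSet.{u}} {g h : X ⟶ Y} (H : HomotopyRel g h) (f : Y ⟶ Z) :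
    HomotopyRel (g ≫ f) (h ≫ f) := by
  rw [homotopyRel_iff] at H ⊢
  obtain ⟨k, h₀, h₁⟩ := H
  exact ⟨k ≫ f, by rw [← h₀, Category.assoc], by rw [← h₁, Category.assoc]⟩

/-- The set `[X, Z]` of simplicial homotopy classes (the quotient by the equivalence relation
generated by simplicial homotopy). -/
def HomotopyClasses (X Z : SSet.{u}) : Type u :=
  Quot (HomotopyRel (X := X) (Z := Z))

/-- Precomposition `[Y, Z] → [X, Z]` with `f : X ⟶ Y`. -/
def HomotopyClasses.precomp {X Y : SSet.{u}} (f : X ⟶ Y) (Z : SSet.{u}) :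
    HomotopyClasses Y Z → HomotopyClasses X Z :=
  Quot.map (fun g ↦ f ≫ g) (fun _ _ H ↦ H.precomp f)

/-- A weak homotopy equivalence of simplicial sets: a map inducing a bijection `[Y, Z] → [X, Z]`
for every Kan complex `Z`. -/
def IsWeakHomotopyEquivalence {X Y : SSet.{u}} (f : X ⟶ Y) : Prop :=
  ∀ (Z : SSet.{u}) [KanComplex Z], Function.Bijective (HomotopyClasses.precomp f Z)

lemma exists_horn_lift {K E B : SSet.{u}} (p : E ⟶ B) [Fibration p] {n : ℕ} {i : Fin (n + 2)}
    (f : ∀ (j : Fin (n + 2)) (_ : j ≠ i), K ⊗ Δ[n] ⟶ E)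
    (hf : horn.IsCompatible (fun j hj ↦ MonoidalClosed.curry (f j hj)))
    (b : K ⊗ Δ[n + 1] ⟶ B) (comm : ∀ j hj, f j hj ≫ p = K ◁ stdSimplex.δ j ≫ b) :
    ∃ φ : K ⊗ Δ[n + 1] ⟶ E, (∀ j, j ≠ i → ∀ hj, K ◁ stdSimplex.δ j ≫ φ = f j hj) ∧ φ ≫ p = b := by
  obtain ⟨φ, h₁, h₂⟩ := hf.exists_lift ((ihom K).map p) (MonoidalClosed.curry b) (fun j hj ↦ by
    rw [← MonoidalClosed.curry_natural_right, ← MonoidalClosed.curry_natural_left, comm])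
  refine ⟨MonoidalClosed.uncurry φ, fun j _ hj ↦ ?_, ?_⟩
  · rw [← MonoidalClosed.uncurry_natural_left, h₁ j hj, MonoidalClosed.uncurry_curry]
  · rw [← MonoidalClosed.uncurry_natural_right, h₂, MonoidalClosed.uncurry_curry]

lemma whiskerLeft_δ_one (X : SSet.{u}) : X ◁ (stdSimplex.δ 1 : Δ[0] ⟶ Δ[1]) =
    CartesianMonoidalCategory.fst _ _ ≫ ι₀ := by
  rw [stdSimplex.δ_one_eq_const]; rfl

lemma whiskerLeft_δ_zero (X : SSet.{u}) : X ◁ (stdSimplex.δ 0 : Δ[0] ⟶ Δ[1]) =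
    CartesianMonoidalCategory.fst _ _ ≫ ι₁ := by
  rw [stdSimplex.δ_zero_eq_const]; rfl

lemma fst_ι₀ {K E : SSet.{u}} (h : K ⊗ Δ[1] ⟶ E) :
    CartesianMonoidalCategory.fst K Δ[0] ≫ ι₀ ≫ h = K ◁ stdSimplex.δ 1 ≫ h := by
  rw [whiskerLeft_δ_one, Category.assoc]

lemma fst_ι₁ {K E : SSet.{u}} (h : K ⊗ Δ[1] ⟶ E) :
    CartesianMonoidalCategory.fst K Δ[0] ≫ ι₁ ≫ h = K ◁ stdSimplex.δ 0 ≫ h := by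
  rw [whiskerLeft_δ_zero, Category.assoc]

lemma whiskerLeft_δ_δ {K E : SSet.{u}} (φ : K ⊗ Δ[2] ⟶ E) {i i' : Fin 2} {j j' : Fin 3}
    (h : stdSimplex.{u}.δ i ≫ stdSimplex.{u}.δ j = stdSimplex.{u}.δ i' ≫ stdSimplex.{u}.δ j') :
    K ◁ (stdSimplex.δ i : Δ[0] ⟶ Δ[1]) ≫ K ◁ stdSimplex.δ j ≫ φ =
      K ◁ stdSimplex.δ i' ≫ K ◁ stdSimplex.δ j' ≫ φ := by
  rw [← MonoidalCategory.whiskerLeft_comp_assoc, ← MonoidalCategory.whiskerLeft_comp_assoc, h]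

lemma fst_cancel {X Y : SSet.{u}} {f g : X ⟶ Y}
    (h : CartesianMonoidalCategory.fst X Δ[0] ≫ f = CartesianMonoidalCategory.fst X Δ[0] ≫ g) :
    f = g := by
  have : CartesianMonoidalCategory.lift (𝟙 X) (SSet.const (stdSimplex.obj₀Equiv.symm 0)) ≫
    CartesianMonoidalCategory.fst X Δ[0] = 𝟙 X := by simp
  rw [← Category.id_comp f, ← Category.id_comp g, ← this, Category.assoc, h, Category.assoc]

/-- Homotopy lifting. -/
lemma exists_homotopy_lift {K E B : SSet.{u}} (p : E ⟶ B) [Fibration p]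
    (f : K ⟶ E) (h : K ⊗ Δ[1] ⟶ B) (hf : ι₀ ≫ h = f ≫ p) :
    ∃ φ : K ⊗ Δ[1] ⟶ E, ι₀ ≫ φ = f ∧ φ ≫ p = h := by
  obtain ⟨φ, h₁, h₂⟩ := exists_horn_lift p (n := 0) (i := 0)
    (fun _ _ ↦ CartesianMonoidalCategory.fst _ _ ≫ f) (by simp) h (fun j hj ↦ by
      obtain rfl : j = 1 := by grind
      rw [whiskerLeft_δ_one, Category.assoc, Category.assoc, hf])
  refine ⟨φ, fst_cancel ?_, h₂⟩
  rw [← h₁ 1 (by simp) (by simp), whiskerLeft_δ_one, Category.assoc]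

/-- Filling of horns of homotopies `Λ[2, 0]` and `Λ[2, 2]`. -/
lemma exists_homotopy_left {K E B : SSet.{u}} (p : E ⟶ B) [Fibration p]
    (h₁ h₂ : K ⊗ Δ[1] ⟶ E) (b : K ⊗ Δ[2] ⟶ B) (h : ι₀ ≫ h₁ = ι₀ ≫ h₂)
    (hb₁ : h₁ ≫ p = K ◁ stdSimplex.δ 1 ≫ b) (hb₂ : h₂ ≫ p = K ◁ stdSimplex.δ 2 ≫ b) :
    ∃ h₀ : K ⊗ Δ[1] ⟶ E, ι₀ ≫ h₀ = ι₁ ≫ h₂ ∧ ι₁ ≫ h₀ = ι₁ ≫ h₁ ∧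
      h₀ ≫ p = K ◁ stdSimplex.δ 0 ≫ b := by
  obtain ⟨φ, hφ, hφ'⟩ := exists_horn_lift p (n := 1) (i := 0)
    (fun j _ ↦ if j = 1 then h₁ else h₂) (by
      rw [horn.isCompatible_iff]
      intro j k hj hk hjk
      obtain rfl : j = 1 := by grind
      obtain rfl : k = 2 := by grind
      simp only [← MonoidalClosed.curry_natural_left]
      congr 1
      change K ◁ stdSimplex.δ 1 ≫ h₁ = K ◁ stdSimplex.δ 1 ≫ h₂
      simp only [whiskerLeft_δ_one, Category.assoc, h]) b (fun j hj ↦ by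
        obtain rfl | rfl : j = 1 ∨ j = 2 := by grind
        · exact hb₁
        · exact hb₂)
  have e₁ : K ◁ stdSimplex.δ 1 ≫ φ = h₁ := hφ 1 (by simp) (by simp)
  have e₂ : K ◁ stdSimplex.δ 2 ≫ φ = h₂ := hφ 2 (by simp) (by simp)
  refine ⟨K ◁ stdSimplex.δ 0 ≫ φ, fst_cancel ?_, fst_cancel ?_, by rw [Category.assoc, hφ']⟩
  · rw [← e₂, fst_ι₀, fst_ι₁]
    exact whiskerLeft_δ_δ φ (stdSimplex.δ_comp_δ (i := 0) (j := 1) (by simp)).symm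
  · rw [← e₁, fst_ι₁, fst_ι₁]
    exact whiskerLeft_δ_δ φ (stdSimplex.δ_comp_δ (i := 0) (j := 0) (by simp)).symm

lemma exists_homotopy_right {K E B : SSet.{u}} (p : E ⟶ B) [Fibration p]
    (h₀ h₁ : K ⊗ Δ[1] ⟶ E) (b : K ⊗ Δ[2] ⟶ B) (h : ι₁ ≫ h₀ = ι₁ ≫ h₁)
    (hb₀ : h₀ ≫ p = K ◁ stdSimplex.δ 0 ≫ b) (hb₁ : h₁ ≫ p = K ◁ stdSimplex.δ 1 ≫ b) :
    ∃ h₂ : K ⊗ Δ[1] ⟶ E, ι₀ ≫ h₂ = ι₀ ≫ h₁ ∧ ι₁ ≫ h₂ = ι₀ ≫ h₀ ∧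
      h₂ ≫ p = K ◁ stdSimplex.δ 2 ≫ b := by
  obtain ⟨φ, hφ, hφ'⟩ := exists_horn_lift p (n := 1) (i := 2)
    (fun j _ ↦ if j = 1 then h₁ else h₀) (by
      rw [horn.isCompatible_iff]
      intro j k hj hk hjk
      obtain rfl : j = 0 := by grind
      obtain rfl : k = 1 := by grind
      simp only [← MonoidalClosed.curry_natural_left]
      congr 1
      change K ◁ stdSimplex.δ 0 ≫ h₀ = K ◁ stdSimplex.δ 0 ≫ h₁
      simp only [whiskerLeft_δ_zero, Category.assoc, h]) b (fun j hj ↦ by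
        obtain rfl | rfl : j = 0 ∨ j = 1 := by grind
        · exact hb₀
        · exact hb₁)
  have e₀ : K ◁ stdSimplex.δ 0 ≫ φ = h₀ := hφ 0 (by simp) (by simp)
  have e₁ : K ◁ stdSimplex.δ 1 ≫ φ = h₁ := hφ 1 (by simp) (by simp)
  refine ⟨K ◁ stdSimplex.δ 2 ≫ φ, fst_cancel ?_, fst_cancel ?_, by rw [Category.assoc, hφ']⟩
  · rw [← e₁, fst_ι₀, fst_ι₀]
    exact whiskerLeft_δ_δ φ (stdSimplex.δ_comp_δ (i := 1) (j := 1) (by simp))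
  · rw [← e₀, fst_ι₀, fst_ι₁]
    exact whiskerLeft_δ_δ φ (stdSimplex.δ_comp_δ (i := 0) (j := 1) (by simp))

lemma HomotopyRel.refl {X Z : SSet.{u}} (f : X ⟶ Z) : HomotopyRel f f := by
  rw [homotopyRel_iff]
  exact ⟨CartesianMonoidalCategory.fst _ _ ≫ f, by simp, by simp⟩

lemma HomotopyRel.left {X Z : SSet.{u}} [KanComplex Z] {f g h : X ⟶ Z}
    (H : HomotopyRel f g) (H' : HomotopyRel f h) : HomotopyRel g h := by
  rw [homotopyRel_iff] at H H' ⊢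
  obtain ⟨k, rfl, rfl⟩ := H
  obtain ⟨k', hk, rfl⟩ := H'
  obtain ⟨k'', h₁, h₂, -⟩ := exists_homotopy_left (Limits.terminal.from Z) k' k
    (Limits.terminal.from _) hk (by simp) (by simp)
  exact ⟨k'', h₁, h₂⟩

lemma equivalence_homotopyRel (X Z : SSet.{u}) [KanComplex Z] :
    Equivalence (HomotopyRel (X := X) (Z := Z)) where
  refl := .refl
  symm h := h.left (.refl _)
  trans h h' := (h.left (.refl _)).left h'

lemma homotopyRel_of_eq {X Z : SSet.{u}} [KanComplex Z] {f g : X ⟶ Z}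
    (h : (Quot.mk _ f : HomotopyClasses X Z) = Quot.mk _ g) : HomotopyRel f g :=
  (equivalence_homotopyRel X Z).eqvGen_iff.1 (Quot.eqvGen_exact h)

/-- A Kan fibration between Kan complexes which is a weak homotopy equivalence has a section,
and the identity is fibrewise homotopic to the corresponding retraction. -/
lemma IsWeakHomotopyEquivalence.exists_section {E B : SSet.{u}} {p : E ⟶ B} [Fibration p]
    [KanComplex E] [KanComplex B] (hp : IsWeakHomotopyEquivalence p) :
    ∃ (s : B ⟶ E) (H : E ⊗ Δ[1] ⟶ E), s ≫ p = 𝟙 B ∧ ι₀ ≫ H = 𝟙 E ∧ ι₁ ≫ H = p ≫ s ∧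
      H ≫ p = CartesianMonoidalCategory.fst _ _ ≫ p := by
  obtain ⟨s₀, hs₀⟩ := (hp E).2 (Quot.mk _ (𝟙 E))
  obtain ⟨s₀, rfl⟩ := Quot.mk_surjective s₀
  replace hs₀ : HomotopyRel (p ≫ s₀) (𝟙 E) := homotopyRel_of_eq hs₀
  have hB : HomotopyRel (s₀ ≫ p) (𝟙 B) := by
    refine homotopyRel_of_eq ((hp B).1 (Quot.sound ?_))
    simpa using hs₀.postcomp p
  obtain ⟨k, hk₀, hk₁⟩ := (homotopyRel_iff _ _).1 hB
  obtain ⟨φ, hφ₀, hφ⟩ := exists_homotopy_lift p s₀ k hk₀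
  obtain ⟨s, hs⟩ : ∃ s, s = ι₁ ≫ φ := ⟨_, rfl⟩
  have hsp : s ≫ p = 𝟙 B := by rw [hs, Category.assoc, hφ, hk₁]
  have hs' : HomotopyRel s₀ s := (homotopyRel_iff _ _).2 ⟨φ, hφ₀, hs.symm⟩
  obtain ⟨h, hh₀, hh₁⟩ := (homotopyRel_iff _ _).1 (hs₀.left (hs'.precomp p))
  obtain ⟨H, e₀, e₁, e₂⟩ := exists_homotopy_right p (h ≫ p ≫ s) h
    (E ◁ stdSimplex.σ 0 ≫ h ≫ p) (by
      rw [← Category.assoc, hh₁, Category.assoc, reassoc_of% hsp])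
    (by
      rw [← MonoidalCategory.whiskerLeft_comp_assoc, stdSimplex.δ_comp_σ_self' (by rfl)]
      simp [hsp])
    (by
      rw [← MonoidalCategory.whiskerLeft_comp_assoc, stdSimplex.δ_comp_σ_succ' (by rfl)]
      simp)
  refine ⟨s, H, hsp, e₀.trans hh₀, ?_, ?_⟩
  · rw [e₁, reassoc_of% hh₀]
  · have : (stdSimplex.δ 2 : Δ[1] ⟶ Δ[2]) ≫ stdSimplex.σ 0 = stdSimplex.σ 0 ≫ stdSimplex.δ 1 :=
      stdSimplex.δ_comp_σ_of_gt (i := 1) (j := 0) (by simp)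
    rw [e₂, ← MonoidalCategory.whiskerLeft_comp_assoc, this,
      MonoidalCategory.whiskerLeft_comp_assoc, whiskerLeft_δ_one, Category.assoc, reassoc_of% hh₀]
    simp
lemma whiskerLeft_δ_σ {K E : SSet.{u}} (φ : K ⊗ Δ[1] ⟶ E) (i : Fin 3) (j : Fin 2)
    (h : stdSimplex.{u}.δ i ≫ stdSimplex.{u}.σ j = 𝟙 _) :
    K ◁ (stdSimplex.δ i : Δ[1] ⟶ Δ[2]) ≫ K ◁ stdSimplex.σ j ≫ φ = φ := by
  rw [← MonoidalCategory.whiskerLeft_comp_assoc, h]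
  simp

lemma whiskerLeft_δ_two_σ_zero {K E : SSet.{u}} (φ : K ⊗ Δ[1] ⟶ E) :
    K ◁ (stdSimplex.δ 2 : Δ[1] ⟶ Δ[2]) ≫ K ◁ stdSimplex.σ 0 ≫ φ =
      CartesianMonoidalCategory.fst _ _ ≫ ι₀ ≫ φ := by
  have : stdSimplex.{u}.δ (2 : Fin 3) ≫ stdSimplex.σ 0 = stdSimplex.σ 0 ≫ stdSimplex.δ 1 :=
    stdSimplex.δ_comp_σ_of_gt (i := 1) (j := 0) (by simp)
  rw [← MonoidalCategory.whiskerLeft_comp_assoc, this,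
      MonoidalCategory.whiskerLeft_comp_assoc, whiskerLeft_δ_one, Category.assoc]
  simp

lemma whiskerLeft_δ_zero_σ_one {K E : SSet.{u}} (φ : K ⊗ Δ[1] ⟶ E) :
    K ◁ (stdSimplex.δ 0 : Δ[1] ⟶ Δ[2]) ≫ K ◁ stdSimplex.σ 1 ≫ φ =
      CartesianMonoidalCategory.fst _ _ ≫ ι₁ ≫ φ := by
  have : stdSimplex.{u}.δ (0 : Fin 3) ≫ stdSimplex.σ 1 = stdSimplex.σ 0 ≫ stdSimplex.δ 0 :=
    stdSimplex.δ_comp_σ_of_le (i := 0) (j := 0) (by simp)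
  rw [← MonoidalCategory.whiskerLeft_comp_assoc, this,
      MonoidalCategory.whiskerLeft_comp_assoc, whiskerLeft_δ_zero, Category.assoc]
  simp

/-- Such a fibration has the right lifting property with respect to
`K × ∂Δ[1] ⟶ K × Δ[1]`. -/
lemma IsWeakHomotopyEquivalence.exists_lift_homotopy {E B : SSet.{u}} {p : E ⟶ B} [Fibration p]
    [KanComplex E] [KanComplex B] (hp : IsWeakHomotopyEquivalence p) {K : SSet.{u}}
    (e₀ e₁ : K ⟶ E) (β : K ⊗ Δ[1] ⟶ B) (h₀ : ι₀ ≫ β = e₀ ≫ p) (h₁ : ι₁ ≫ β = e₁ ≫ p) :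
    ∃ ε : K ⊗ Δ[1] ⟶ E, ι₀ ≫ ε = e₀ ∧ ι₁ ≫ ε = e₁ ∧ ε ≫ p = β := by
  obtain ⟨s, H, hs, H₀, H₁, Hp⟩ := hp.exists_section
  have hf : ∀ e : K ⟶ E, ι₀ ≫ e ▷ _ ≫ H = e ∧ ι₁ ≫ e ▷ _ ≫ H = e ≫ p ≫ s ∧
      (e ▷ _ ≫ H) ≫ p = CartesianMonoidalCategory.fst _ _ ≫ e ≫ p := fun e ↦
    ⟨by rw [ι₀_comp_assoc, H₀, Category.comp_id], by rw [ι₁_comp_assoc, H₁],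
      by rw [Category.assoc, Hp]; simp⟩
  obtain ⟨a₀, a₁, ap⟩ := hf e₀
  obtain ⟨b₀, b₁, bp⟩ := hf e₁
  obtain ⟨r, r₀, r₁, rp⟩ := exists_homotopy_left p (CartesianMonoidalCategory.fst _ _ ≫ e₀)
    (e₀ ▷ _ ≫ H) (CartesianMonoidalCategory.fst _ _ ≫ e₀ ≫ p) (by rw [a₀]; simp)
    (by simp) (by rw [ap]; simp)
  obtain ⟨m, m₀, m₁, mp⟩ := exists_homotopy_left p (β ≫ s) r (K ◁ stdSimplex.σ 0 ≫ β)
    (by rw [r₀, a₁, ← Category.assoc, h₀, Category.assoc])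
    (by rw [whiskerLeft_δ_σ _ _ _ (stdSimplex.δ_comp_σ_succ' (by rfl)), Category.assoc, hs,
          Category.comp_id])
    (by rw [rp, whiskerLeft_δ_two_σ_zero, h₀]; simp)
  obtain ⟨ε, k₀, k₁, kp⟩ := exists_homotopy_right p (e₁ ▷ _ ≫ H) m (K ◁ stdSimplex.σ 1 ≫ β)
    (by rw [b₁, m₁, ← Category.assoc, ← h₁, Category.assoc])
    (by rw [bp, whiskerLeft_δ_zero_σ_one, h₁])
    (by rw [mp, whiskerLeft_δ_σ _ _ _ (stdSimplex.δ_comp_σ_self' (by rfl)),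
          whiskerLeft_δ_σ _ _ _ (stdSimplex.δ_comp_σ_self' (by rfl))])
  refine ⟨ε, ?_, ?_, ?_⟩
  · rw [k₀, m₀, r₁]; simp
  · rw [k₁, b₀]
  · rw [kp, whiskerLeft_δ_σ _ _ _ (stdSimplex.δ_comp_σ_succ' (by rfl))]

lemma IsWeakHomotopyEquivalence.exists_vertex {E B : SSet.{u}} {p : E ⟶ B} [Fibration p]
    [KanComplex E] [KanComplex B] (hp : IsWeakHomotopyEquivalence p) (b : B _⦋0⦌) :
    ∃ e : E _⦋0⦌, p.app _ e = b := by
  obtain ⟨s, -, hs, -⟩ := hp.exists_section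
  exact ⟨s.app _ b, ConcreteCategory.congr_hom (NatTrans.congr_app hs (op ⦋0⦌)) b⟩

lemma IsWeakHomotopyEquivalence.exists_edge {E B : SSet.{u}} {p : E ⟶ B} [Fibration p]
    [KanComplex E] [KanComplex B] (hp : IsWeakHomotopyEquivalence p)
    (e₀ e₁ : E _⦋0⦌) (β : B _⦋1⦌) (h₀ : B.δ 1 β = p.app _ e₀) (h₁ : B.δ 0 β = p.app _ e₁) :
    ∃ ε : E _⦋1⦌, E.δ 1 ε = e₀ ∧ E.δ 0 ε = e₁ ∧ p.app _ ε = β := by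
  have key₀ : ∀ {Y : SSet.{u}} (y : Y _⦋1⦌),
      (SSet.const (stdSimplex.obj₀Equiv.symm 0) : Δ[0] ⟶ Δ[1]) ≫ SSet.yonedaEquiv.symm y =
        SSet.yonedaEquiv.symm (Y.δ 1 y) := fun y ↦ by
    rw [← stdSimplex.δ_one_eq_const]
    exact yonedaEquiv_symm_naturality_left _ _
  have key₁ : ∀ {Y : SSet.{u}} (y : Y _⦋1⦌),
      (SSet.const (stdSimplex.obj₀Equiv.symm 1) : Δ[0] ⟶ Δ[1]) ≫ SSet.yonedaEquiv.symm y =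
        SSet.yonedaEquiv.symm (Y.δ 0 y) := fun y ↦ by
    rw [← stdSimplex.δ_zero_eq_const]
    exact yonedaEquiv_symm_naturality_left _ _
  obtain ⟨ε, a₀, a₁, a⟩ := hp.exists_lift_homotopy (K := Δ[0]) (SSet.yonedaEquiv.symm e₀)
    (SSet.yonedaEquiv.symm e₁) (CartesianMonoidalCategory.snd _ _ ≫ SSet.yonedaEquiv.symm β) (by
      rw [ι₀_snd_assoc, key₀, h₀, yonedaEquiv_symm_comp]) (by
      rw [ι₁_snd_assoc, key₁, h₁, yonedaEquiv_symm_comp])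
  let l : Δ[1] ⟶ (Δ[0] ⊗ Δ[1] : SSet.{u}) :=
    CartesianMonoidalCategory.lift (stdSimplex.isTerminalObj₀.from _) (𝟙 _)
  obtain ⟨y, hy⟩ := SSet.yonedaEquiv.symm.surjective (l ≫ ε)
  refine ⟨y, ?_, ?_, ?_⟩
  · apply SSet.yonedaEquiv.symm.injective
    rw [← key₀, hy, ← a₀, ← Category.assoc]
    congr 1
    exact CartesianMonoidalCategory.hom_ext _ _ stdSimplex.ext₀ rfl
  · apply SSet.yonedaEquiv.symm.injective
    rw [← key₁, hy, ← a₁, ← Category.assoc]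
    congr 1
    exact CartesianMonoidalCategory.hom_ext _ _ stdSimplex.ext₀ rfl
  · apply SSet.yonedaEquiv.symm.injective
    rw [← yonedaEquiv_symm_comp, hy, Category.assoc, a]
    rfl

/-- A bisimplicial set `X`, as a simplicial object in simplicial sets: `X _⦋n⦌` is the `n`-th
column `X_{n, •}` and `X _⦋n⦌ _⦋m⦌` is the set `X_{n, m}`. The horizontal operators
`d_{i, •}`, `s_{i, •}` are `X.δ i`, `X.σ i`, and the vertical operators `d_{•, i}`, `s_{•, i}` are
the operators `δ i`, `σ i` of the columns. -/
abbrev BisimplicialSet : Type (u + 1) := SimplicialObject SSet.{u}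

namespace BisimplicialSet

/-- The transpose of a bisimplicial set: `X.transpose _⦋m⦌` is the `m`-th row `X_{•, m}`. -/
def transpose (X : BisimplicialSet.{u}) : BisimplicialSet.{u} := Functor.flip X

/-- The simplicial set `M_v(K, X)`, with `M_v(K, X)_m = Hom(K, X_{•, m})`. -/
def Mv (K : SSet.{u}) (X : BisimplicialSet.{u}) : SSet.{u} :=
  X.transpose ⋙ coyoneda.obj (op K)

/-- The map `M_v(L, X) ⟶ M_v(K, X)` induced by `i : K ⟶ L`. -/
def MvMap {K L : SSet.{u}} (i : K ⟶ L) (X : BisimplicialSet.{u}) : Mv L X ⟶ Mv K X :=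
  Functor.whiskerLeft X.transpose (coyoneda.map i.op)

/-- Fibrancy in the vertical Reedy model structure: for all `n`, the matching map
`X_{n, •} ≅ M_v(Δ[n], X) ⟶ M_v(∂Δ[n], X)` is a Kan fibration. -/
def IsReedyFibrant (X : BisimplicialSet.{u}) : Prop :=
  ∀ n : ℕ, Fibration (MvMap ∂Δ[n].ι X)

/-- The spine of `Δ[n]` (for `n ≥ 1`): the simplicial subset generated by the principal edges
`i → i + 1`. -/
def spine (n : ℕ) : (Δ[n] : SSet.{u}).Subcomplex :=
  ⨆ i : Fin n, Subcomplex.ofSimplex (stdSimplex.objEquiv.symm (SimplexCategory.mkOfSucc i))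

/-- The Segal condition: `X_{n, •} ≅ M_v(Δ[n], X) ⟶ M_v(spine n, X)` is a weak homotopy equivalence
for all `n ≥ 1`. -/
def SegalCondition (X : BisimplicialSet.{u}) : Prop :=
  ∀ n : ℕ, 1 ≤ n → IsWeakHomotopyEquivalence (MvMap (spine.{u} n).ι X)

/-- Segal spaces: vertically Reedy fibrant bisimplicial sets satisfying the Segal condition. -/
class IsSegalSpace (X : BisimplicialSet.{u}) : Prop where
  isReedyFibrant : X.IsReedyFibrant
  segalCondition : X.SegalCondition

/-- Transposition of maps into `M_v`. -/
def swap {K L : SSet.{u}} {X : BisimplicialSet.{u}} (a : L ⟶ Mv K X) : K ⟶ Mv L X.transpose where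
  app n := ↾fun k ↦
    { app := fun m ↦ ↾fun l ↦ (show K ⟶ X.transpose.obj m from a.app m l).app n k
      naturality := fun m m' f ↦ by
        ext l
        exact ConcreteCategory.congr_hom (NatTrans.congr_app
          (ConcreteCategory.congr_hom (a.naturality f) l) n) k }
  naturality n n' f := by
    ext k
    apply NatTrans.ext
    funext m
    ext l
    exact ConcreteCategory.congr_hom
      ((show K ⟶ X.transpose.obj m from a.app m l).naturality f) k

lemma swap_swap {K L : SSet.{u}} {X : BisimplicialSet.{u}} (a : L ⟶ Mv K X) :
    swap (X := X.transpose) (swap a) = a := rfl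

lemma hasLiftingProperty_swap {A K Λ D : SSet.{u}} (i : A ⟶ K) (j : Λ ⟶ D)
    (X : BisimplicialSet.{u}) [HasLiftingProperty i (MvMap j X.transpose)] :
    HasLiftingProperty j (MvMap i X) where
  sq_hasLift {f g} sq := by
    have sq' : CommSq (swap g) i (MvMap j X.transpose) (swap f) := ⟨by
      have := congr_arg swap sq.w
      exact this.symm⟩
    refine ⟨⟨swap (X := X.transpose) sq'.lift, ?_, ?_⟩⟩
    · exact congr_arg (swap (X := X.transpose)) sq'.fac_right
    · exact congr_arg (swap (X := X.transpose)) sq'.fac_left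

lemma IsReedyFibrant.fibration {X : BisimplicialSet.{u}} (hX : X.IsReedyFibrant)
    {A K : SSet.{u}} (i : A ⟶ K) [Mono i] : Fibration (MvMap i X) := by
  rw [fibration_iff]
  intro Λ D j hj
  have h₀ : ∀ n, HasLiftingProperty ∂Δ[n].ι (MvMap j (transpose X)) := fun n ↦ by
    have : HasLiftingProperty j (MvMap ∂Δ[n].ι (transpose (transpose X))) :=
      (modelCategoryQuillen.fibration_iff _).1 (hX n) j hj
    exact hasLiftingProperty_swap j ∂Δ[n].ι (transpose X)
  have h : modelCategoryQuillen.I.rlp (MvMap j (transpose X)) := by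
    rintro _ _ _ ⟨n⟩
    exact h₀ n
  rw [← rlp_monomorphisms] at h
  have := h i (.infer_property i)
  exact hasLiftingProperty_swap i j X

lemma IsReedyFibrant.kanComplex {X : BisimplicialSet.{u}} (hX : X.IsReedyFibrant)
    (K : SSet.{u}) : KanComplex (Mv K X) := by
  have : Fibration (MvMap (⊥ : K.Subcomplex).ι X) := hX.fibration _
  have hT : Limits.IsTerminal (Mv ((⊥ : K.Subcomplex) : SSet) X) :=
    Limits.IsTerminal.ofUniqueHom
      (fun Y ↦ { app := fun m ↦ ↾fun _ ↦ Subcomplex.isInitialBot.to _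
                 naturality := fun _ _ _ ↦ by
                  ext
                  exact Subcomplex.isInitialBot.hom_ext _ _ })
      (fun Y f ↦ by
        ext m y
        exact Subcomplex.isInitialBot.hom_ext _ _)
  exact (isFibrant_iff_of_isTerminal (MvMap (⊥ : K.Subcomplex).ι X) hT).2 inferInstance


lemma mem_spine_iff {n : ℕ} {m : SimplexCategoryᵒᵖ} (s : (Δ[n] : SSet.{u}).obj m) :
    s ∈ (spine.{u} n).obj m ↔ ∃ (i : Fin n) (f : m.unop ⟶ ⦋1⦌),
      s = stdSimplex.objEquiv.symm (f ≫ SimplexCategory.mkOfSucc i) := by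
  simp only [spine, Subfunctor.iSup_obj, Set.mem_iUnion, Subcomplex.mem_ofSimplex_obj_iff]
  refine exists_congr fun i ↦ exists_congr fun f ↦ ?_
  exact eq_comm

/-- The `i`-th principal edge of the spine. -/
def spineEdge {n : ℕ} (i : Fin n) : (spine.{u} n : SSet.{u}) _⦋1⦌ :=
  ⟨stdSimplex.objEquiv.symm (SimplexCategory.mkOfSucc i),
    (mem_spine_iff _).2 ⟨i, 𝟙 _, by simp⟩⟩

lemma spine_hom_ext {n : ℕ} {Y : SSet.{u}} {f g : (spine.{u} n : SSet.{u}) ⟶ Y}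
    (h : ∀ i : Fin n, f.app _ (spineEdge i) = g.app _ (spineEdge i)) : f = g := by
  ext m ⟨s, hs⟩
  obtain ⟨i, φ, rfl⟩ := (mem_spine_iff _).1 hs
  exact (ConcreteCategory.congr_hom (f.naturality φ.op) (spineEdge i)).trans
    ((congr_arg (Y.map φ.op) (h i)).trans
      (ConcreteCategory.congr_hom (g.naturality φ.op) (spineEdge i)).symm)

/-- The monotone map `[n] ⟶ [1]` sending `j ≤ i` to `0` and `j > i` to `1`. -/
def cut {n : ℕ} (i : Fin n) : ⦋n⦌ ⟶ ⦋1⦌ :=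
  SimplexCategory.Hom.mk
    { toFun := fun j ↦ if j ≤ i.castSucc then 0 else 1
      monotone' := fun a b hab ↦ by
        dsimp only
        split_ifs with h₁ h₂
        · rfl
        · exact Fin.zero_le _
        · exact absurd (hab.trans (by assumption)) h₁
        · rfl }

/-- The index of a principal edge containing a given simplex of the spine. -/
def spineIndex {n : ℕ} {m : SimplexCategory} (s : m ⟶ ⦋n + 1⦌) : Fin (n + 1) :=
  ⟨min (s.toOrderHom 0) n, by omega⟩

lemma spine_key {n : ℕ} {Y : SSet.{u}} (f : Fin (n + 1) → Y _⦋1⦌)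
    (hf : ∀ i j : Fin (n + 1), j.val = i.val + 1 → Y.δ 0 (f i) = Y.δ 1 (f j))
    {m : SimplexCategory} (i : Fin (n + 1)) (φ : m ⟶ ⦋1⦌) :
    Y.map ((φ ≫ SimplexCategory.mkOfSucc i) ≫
        cut (spineIndex (φ ≫ SimplexCategory.mkOfSucc i))).op
      (f (spineIndex (φ ≫ SimplexCategory.mkOfSucc i))) = Y.map φ.op (f i) := by
  have hcut : ∀ i : Fin (n + 1), SimplexCategory.mkOfSucc i ≫ cut i = 𝟙 _ := fun i ↦ by
    ext j
    fin_cases j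
    · change ((if i.castSucc ≤ i.castSucc then (0 : Fin 2) else 1) : Fin 2).val = 0
      simp
    · change ((if i.succ ≤ i.castSucc then (0 : Fin 2) else 1) : Fin 2).val = 1
      simp
  by_cases h : spineIndex (φ ≫ SimplexCategory.mkOfSucc i) = i
  · rw [h, Category.assoc, hcut, Category.comp_id]
  · have h₀ : φ.toOrderHom 0 = 1 := by
      by_contra h'
      have h' : φ.toOrderHom 0 = 0 := by
        exact (Fin.exists_fin_two.1 ⟨φ.toOrderHom 0, rfl⟩).elim id
          (fun h'' ↦ absurd h'' h')
      apply h
      ext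
      have : (φ ≫ SimplexCategory.mkOfSucc i).toOrderHom 0 = i.castSucc := by
        simp [h']
      simp only [spineIndex, this]
      have := i.isLt
      simp
      omega
    have hφ : φ = SimplexCategory.const _ _ 1 := by
      ext j : 3
      have : φ.toOrderHom 0 ≤ φ.toOrderHom j := φ.toOrderHom.monotone (Fin.zero_le _)
      rw [h₀] at this
      exact le_antisymm (Fin.le_last _) this
    have hφ' : φ ≫ SimplexCategory.mkOfSucc i = SimplexCategory.const _ _ i.succ := by
      rw [hφ, SimplexCategory.const_comp]
      rfl
    have hv : (spineIndex (φ ≫ SimplexCategory.mkOfSucc i)).val = min (i.val + 1) n := by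
      simp only [spineIndex, hφ', SimplexCategory.const_apply]
      rfl
    have hj : (spineIndex (φ ≫ SimplexCategory.mkOfSucc i)).val = i.val + 1 := by
      have : (spineIndex (φ ≫ SimplexCategory.mkOfSucc i)).val ≠ i.val := fun h' ↦ h (Fin.ext h')
      have := i.isLt
      omega
    have hY := hf i _ hj
    generalize spineIndex (φ ≫ SimplexCategory.mkOfSucc i) = j at hj hY
    have e₁ : φ = SimplexCategory.const _ ⦋0⦌ 0 ≫ SimplexCategory.δ 0 := by
      rw [hφ, SimplexCategory.const_comp]
      rfl
    have e₂ : (φ ≫ SimplexCategory.mkOfSucc i) ≫ cut j =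
        SimplexCategory.const _ ⦋0⦌ 0 ≫ SimplexCategory.δ 1 := by
      rw [hφ', SimplexCategory.const_comp, SimplexCategory.const_comp]
      congr 1
      change (if i.succ ≤ j.castSucc then (0 : Fin 2) else 1) = 0
      rw [if_pos]
      rw [Fin.le_def]
      simp [hj]
    rw [e₂, e₁]
    rw [op_comp, op_comp, Functor.map_comp_apply, Functor.map_comp_apply]
    exact congr_arg _ hY.symm

/-- The map out of the spine given by a string of composable edges. -/
def spineDesc {n : ℕ} {Y : SSet.{u}} (f : Fin (n + 1) → Y _⦋1⦌)
    (hf : ∀ i j : Fin (n + 1), j.val = i.val + 1 → Y.δ 0 (f i) = Y.δ 1 (f j)) :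
    (spine.{u} (n + 1) : SSet.{u}) ⟶ Y where
  app m := ↾fun s ↦ Y.map (stdSimplex.objEquiv s.1 ≫ cut (spineIndex (stdSimplex.objEquiv s.1))).op
    (f (spineIndex (stdSimplex.objEquiv s.1)))
  naturality m m' θ := by
    ext ⟨s, hs⟩
    obtain ⟨i, φ, rfl⟩ := (mem_spine_iff _).1 hs
    have e₁ := spine_key f hf i φ
    have e₂ := spine_key f hf i (θ.unop ≫ φ)
    refine e₂.trans (Eq.trans ?_ (congr_arg (Y.map θ) e₁.symm))
    rw [op_comp, Functor.map_comp_apply]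
    rfl

lemma spineDesc_app {n : ℕ} {Y : SSet.{u}} (f : Fin (n + 1) → Y _⦋1⦌)
    (hf : ∀ i j : Fin (n + 1), j.val = i.val + 1 → Y.δ 0 (f i) = Y.δ 1 (f j)) (i : Fin (n + 1)) :
    (spineDesc f hf).app _ (spineEdge i) = f i := by
  have := spine_key f hf i (𝟙 _)
  rw [Category.id_comp] at this
  exact this.trans (by simp)

/-- The identification `X_{n, m} ≅ M_v(Δ[n], X)_m` (Yoneda). -/
def toMv {X : BisimplicialSet.{u}} {n : ℕ} {m : SimplexCategoryᵒᵖ} (s : (X _⦋n⦌).obj m) :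
    (Mv Δ[n] X).obj m :=
  SSet.yonedaEquiv.symm (show (X.transpose.obj m) _⦋n⦌ from s)

/-- The element of `X_{n, m}` corresponding to an element of `M_v(Δ[n], X)_m`. -/
def ofMv {X : BisimplicialSet.{u}} {n : ℕ} {m : SimplexCategoryᵒᵖ} (s : (Mv Δ[n] X).obj m) :
    (X _⦋n⦌).obj m :=
  SSet.yonedaEquiv (X := X.transpose.obj m) s

lemma toMv_ofMv {X : BisimplicialSet.{u}} {n : ℕ} {m : SimplexCategoryᵒᵖ}
    (s : (Mv Δ[n] X).obj m) : toMv (ofMv s) = s :=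
  SSet.yonedaEquiv.symm_apply_apply _

lemma ofMv_toMv {X : BisimplicialSet.{u}} {n : ℕ} {m : SimplexCategoryᵒᵖ}
    (s : (X _⦋n⦌).obj m) : ofMv (toMv s) = s :=
  SSet.yonedaEquiv.apply_symm_apply _

lemma ofMv_map {X : BisimplicialSet.{u}} {n : ℕ} {m m' : SimplexCategoryᵒᵖ} (θ : m ⟶ m')
    (s : (Mv Δ[n] X).obj m) : ofMv ((Mv Δ[n] X).map θ s) = (X _⦋n⦌).map θ (ofMv s) := rfl

/-- The `i`-th principal edge of an element of `M_v(spine n, X)_m`. -/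
def edgeAt {X : BisimplicialSet.{u}} {n : ℕ} {m : SimplexCategoryᵒᵖ}
    (b : (Mv (spine.{u} n) X).obj m) (i : Fin n) : (X _⦋1⦌).obj m :=
  (show (spine.{u} n : SSet.{u}) ⟶ X.transpose.obj m from b).app _ (spineEdge i)

lemma edgeAt_ext {X : BisimplicialSet.{u}} {n : ℕ} {m : SimplexCategoryᵒᵖ}
    {b b' : (Mv (spine.{u} n) X).obj m} (h : ∀ i, edgeAt b i = edgeAt b' i) : b = b' :=
  spine_hom_ext h

lemma edgeAt_map {X : BisimplicialSet.{u}} {n : ℕ} {m m' : SimplexCategoryᵒᵖ} (θ : m ⟶ m')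
    (b : (Mv (spine.{u} n) X).obj m) (i : Fin n) :
    edgeAt ((Mv (spine.{u} n) X).map θ b) i = (X _⦋1⦌).map θ (edgeAt b i) := rfl

/-- The `i`-th principal edge of an element of `X_{n, m}`. -/
def principal (X : BisimplicialSet.{u}) {n : ℕ} (i : Fin n) : X _⦋n⦌ ⟶ X _⦋1⦌ :=
  X.map (SimplexCategory.mkOfSucc i).op

lemma edgeAt_MvMap {X : BisimplicialSet.{u}} {n : ℕ} {m : SimplexCategoryᵒᵖ}
    (s : (Mv Δ[n] X).obj m) (i : Fin n) :
    edgeAt ((MvMap (spine.{u} n).ι X).app m s) i = (X.principal i).app m (ofMv s) := by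
  obtain ⟨s, rfl⟩ : ∃ t, s = toMv t := ⟨_, (toMv_ofMv s).symm⟩
  rw [ofMv_toMv]
  rfl

lemma exists_edgeAt {X : BisimplicialSet.{u}} {n : ℕ} {m : SimplexCategoryᵒᵖ}
    (f : Fin (n + 1) → (X _⦋1⦌).obj m)
    (hf : ∀ i j : Fin (n + 1), j.val = i.val + 1 →
      (X.δ 0).app m (f i) = (X.δ 1).app m (f j)) :
    ∃ b : (Mv (spine.{u} (n + 1)) X).obj m, ∀ i, edgeAt b i = f i :=
  ⟨spineDesc (Y := X.transpose.obj m) f hf, spineDesc_app (Y := X.transpose.obj m) f hf⟩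

section

variable {X : BisimplicialSet.{u}} [hX : X.IsSegalSpace]

lemma IsSegalSpace.exists_vertex {n : ℕ} (f : Fin (n + 1) → (X _⦋1⦌) _⦋0⦌)
    (hf : ∀ i j : Fin (n + 1), j.val = i.val + 1 →
      (X.δ 0).app _ (f i) = (X.δ 1).app _ (f j)) :
    ∃ T : (X _⦋n + 1⦌) _⦋0⦌, ∀ i, (X.principal i).app _ T = f i := by
  have := hX.isReedyFibrant.fibration (spine.{u} (n + 1)).ι
  have := hX.isReedyFibrant.kanComplex Δ[n + 1]
  have := hX.isReedyFibrant.kanComplex (spine.{u} (n + 1))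
  obtain ⟨b, hb⟩ := exists_edgeAt f hf
  obtain ⟨T, hT⟩ := (hX.segalCondition (n + 1) (by omega)).exists_vertex b
  refine ⟨ofMv T, fun i ↦ ?_⟩
  rw [← hb, ← hT]
  exact (edgeAt_MvMap T i).symm

lemma IsSegalSpace.exists_edge {n : ℕ} (T₀ T₁ : (X _⦋n + 1⦌) _⦋0⦌)
    (β : Fin (n + 1) → (X _⦋1⦌) _⦋1⦌)
    (hβ : ∀ i j : Fin (n + 1), j.val = i.val + 1 →
      (X.δ 0).app _ (β i) = (X.δ 1).app _ (β j))
    (h₀ : ∀ i, (X _⦋1⦌).δ 1 (β i) = (X.principal i).app _ T₀)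
    (h₁ : ∀ i, (X _⦋1⦌).δ 0 (β i) = (X.principal i).app _ T₁) :
    ∃ ε : (X _⦋n + 1⦌) _⦋1⦌, (X _⦋n + 1⦌).δ 1 ε = T₀ ∧ (X _⦋n + 1⦌).δ 0 ε = T₁ ∧
      ∀ i, (X.principal i).app _ ε = β i := by
  have := hX.isReedyFibrant.fibration (spine.{u} (n + 1)).ι
  have := hX.isReedyFibrant.kanComplex Δ[n + 1]
  have := hX.isReedyFibrant.kanComplex (spine.{u} (n + 1))
  obtain ⟨b, hb⟩ := exists_edgeAt β hβ
  obtain ⟨ε, a₀, a₁, a⟩ := (hX.segalCondition (n + 1) (by omega)).exists_edge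
    (toMv T₀) (toMv T₁) b (edgeAt_ext fun i ↦ by
      rw [edgeAt_MvMap, ofMv_toMv, ← h₀, ← hb]
      rfl) (edgeAt_ext fun i ↦ by
      rw [edgeAt_MvMap, ofMv_toMv, ← h₁, ← hb]
      rfl)
  refine ⟨ofMv ε, ?_, ?_, fun i ↦ ?_⟩
  · rw [← ofMv_toMv T₀, ← a₀]
    rfl
  · rw [← ofMv_toMv T₁, ← a₁]
    rfl
  · rw [← edgeAt_MvMap, a, hb]

end

/-- The constant `m`-simplex of `X_{0, •}` at a vertex `x`. -/
def constAt (X : BisimplicialSet.{u}) (m : SimplexCategoryᵒᵖ) (x : (X _⦋0⦌) _⦋0⦌) :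
    (X _⦋0⦌).obj m :=
  (X _⦋0⦌).map (SimplexCategory.const m.unop ⦋0⦌ 0).op x

lemma map_constAt {X : BisimplicialSet.{u}} {m m' : SimplexCategoryᵒᵖ} (θ : m ⟶ m')
    (x : (X _⦋0⦌) _⦋0⦌) : (X _⦋0⦌).map θ (X.constAt m x) = X.constAt m' x := by
  dsimp only [constAt]
  rw [← Functor.map_comp_apply]
  rfl

lemma constAt_zero (X : BisimplicialSet.{u}) (x : (X _⦋0⦌) _⦋0⦌) : X.constAt (op ⦋0⦌) x = x := by
  have : SimplexCategory.const ⦋0⦌ ⦋0⦌ 0 = 𝟙 _ := SimplexCategory.const_eq_id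
  simp only [constAt, this]
  simp

/-- The mapping space `X(x₀, …, xₙ)`: the fibre over `(x₀, …, xₙ)` of the map
`X_{n, •} ⟶ X_{0, •} × ⋯ × X_{0, •}` whose components are induced by the vertices
`[0] ⟶ [n]`. -/
def mapSpace (X : BisimplicialSet.{u}) {n : ℕ} (x : Fin (n + 1) → (X _⦋0⦌) _⦋0⦌) :
    (X _⦋n⦌).Subcomplex where
  obj m := {s | ∀ i : Fin (n + 1),
    (X.map (SimplexCategory.const ⦋0⦌ ⦋n⦌ i).op).app m s = X.constAt m (x i)}
  map θ s hs i :=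
    (ConcreteCategory.congr_hom ((X.map (SimplexCategory.const ⦋0⦌ ⦋n⦌ i).op).naturality θ) s).trans
      ((congr_arg ((X _⦋0⦌).map θ) (hs i)).trans (map_constAt θ _))

lemma map_app_comp (X : BisimplicialSet.{u}) {m : SimplexCategoryᵒᵖ} {a b c : SimplexCategory}
    (f : a ⟶ b) (g : b ⟶ c) (s : (X.obj (op c)).obj m) :
    (X.map f.op).app m ((X.map g.op).app m s) = (X.map (f ≫ g).op).app m s := by
  rw [op_comp, X.map_comp]
  rfl

/-- The map of mapping spaces induced by `θ : [k] ⟶ [n]`. -/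
def mapSpaceMap (X : BisimplicialSet.{u}) {n k : ℕ} (θ : ⦋k⦌ ⟶ ⦋n⦌)
    {x : Fin (n + 1) → (X _⦋0⦌) _⦋0⦌} {y : Fin (k + 1) → (X _⦋0⦌) _⦋0⦌}
    (h : ∀ i, x (θ.toOrderHom i) = y i) :
    (X.mapSpace x : SSet.{u}) ⟶ X.mapSpace y :=
  Subcomplex.lift ((X.mapSpace x).ι ≫ X.map θ.op) (by
    rintro m _ ⟨⟨s, hs⟩, rfl⟩ i
    refine (map_app_comp X _ θ s).trans ?_
    rw [SimplexCategory.const_comp, ← h]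
    exact hs _)

lemma mem_mapSpace_pair {X : BisimplicialSet.{u}} {m : SimplexCategoryᵒᵖ} {x y : (X _⦋0⦌) _⦋0⦌}
    (s : (X _⦋1⦌).obj m) : s ∈ (X.mapSpace ![x, y]).obj m ↔
      (X.δ 1).app m s = X.constAt m x ∧ (X.δ 0).app m s = X.constAt m y := by
  have h₀ : SimplexCategory.const ⦋0⦌ ⦋1⦌ 0 = SimplexCategory.δ (1 : Fin 2) :=
    (SimplexCategory.eq_const_of_zero (SimplexCategory.δ (1 : Fin 2))).symm
  have h₁ : SimplexCategory.const ⦋0⦌ ⦋1⦌ 1 = SimplexCategory.δ (0 : Fin 2) :=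
    (SimplexCategory.eq_const_of_zero (SimplexCategory.δ (0 : Fin 2))).symm
  constructor
  · intro h
    have a₀ := h 0
    have a₁ := h 1
    rw [h₀] at a₀
    rw [h₁] at a₁
    exact ⟨a₀, a₁⟩
  · rintro ⟨a₀, a₁⟩ i
    fin_cases i
    · dsimp
      rw [h₀]
      exact a₀
    · dsimp
      rw [h₁]
      exact a₁

lemma mem_mapSpace_of_principal {X : BisimplicialSet.{u}} {m : SimplexCategoryᵒᵖ} {n : ℕ}
    {x : Fin (n + 2) → (X _⦋0⦌) _⦋0⦌} (s : (X _⦋n + 1⦌).obj m)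
    (h : ∀ i : Fin (n + 1),
      (X.principal i).app m s ∈ (X.mapSpace ![x i.castSucc, x i.succ]).obj m) :
    s ∈ (X.mapSpace x).obj m := by
  intro i
  obtain ⟨j, rfl | rfl⟩ : ∃ j : Fin (n + 1), i = j.castSucc ∨ i = j.succ := by
    induction i using Fin.cases with
    | zero => exact ⟨0, Or.inl rfl⟩
    | succ i => exact ⟨i, Or.inr rfl⟩
  · refine Eq.trans ?_ (h j 0)
    refine Eq.trans ?_ (map_app_comp X _ _ s).symm
    rw [SimplexCategory.const_comp]
    rfl
  · refine Eq.trans ?_ (h j 1)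
    refine Eq.trans ?_ (map_app_comp X _ _ s).symm
    rw [SimplexCategory.const_comp]
    rfl

/-- The set of connected components of `X(x, y)`. -/
abbrev HomSet (X : BisimplicialSet.{u}) (x y : (X _⦋0⦌) _⦋0⦌) : Type u :=
  π₀ (X.mapSpace ![x, y] : SSet.{u})

/-- The map `d_{2, •} : X(x, y, z) ⟶ X(x, y)`. -/
def face₂ (X : BisimplicialSet.{u}) (x y z : (X _⦋0⦌) _⦋0⦌) :
    (X.mapSpace ![x, y, z] : SSet.{u}) ⟶ X.mapSpace ![x, y] :=
  X.mapSpaceMap (SimplexCategory.δ (2 : Fin 3)) (by intro i; fin_cases i <;> rfl)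

/-- The map `d_{0, •} : X(x, y, z) ⟶ X(y, z)`. -/
def face₀ (X : BisimplicialSet.{u}) (x y z : (X _⦋0⦌) _⦋0⦌) :
    (X.mapSpace ![x, y, z] : SSet.{u}) ⟶ X.mapSpace ![y, z] :=
  X.mapSpaceMap (SimplexCategory.δ (0 : Fin 3)) (by intro i; fin_cases i <;> rfl)

/-- The map `d_{1, •} : X(x, y, z) ⟶ X(x, z)`. -/
def face₁ (X : BisimplicialSet.{u}) (x y z : (X _⦋0⦌) _⦋0⦌) :
    (X.mapSpace ![x, y, z] : SSet.{u}) ⟶ X.mapSpace ![x, z] :=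
  X.mapSpaceMap (SimplexCategory.δ (1 : Fin 3)) (by intro i; fin_cases i <;> rfl)

/-- The map `π₀ X(x, y, z) → π₀ X(x, y) × π₀ X(y, z)` induced by `(d_{2, •}, d_{0, •})`. -/
def segalπ₀ (X : BisimplicialSet.{u}) (x y z : (X _⦋0⦌) _⦋0⦌)
    (t : π₀ (X.mapSpace ![x, y, z] : SSet.{u})) : X.HomSet x y × X.HomSet y z :=
  (mapπ₀ (X.face₂ x y z) t, mapπ₀ (X.face₀ x y z) t)

lemma principal_two_zero (X : BisimplicialSet.{u}) : X.principal (0 : Fin 2) = X.δ 2 :=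
  congr_arg (fun f : ⦋1⦌ ⟶ ⦋2⦌ ↦ X.map f.op) SimplexCategory.mkOfSucc_zero_eq_δ

lemma principal_two_one (X : BisimplicialSet.{u}) : X.principal (1 : Fin 2) = X.δ 0 :=
  congr_arg (fun f : ⦋1⦌ ⟶ ⦋2⦌ ↦ X.map f.op) SimplexCategory.mkOfSucc_one_eq_δ

section

variable {X : BisimplicialSet.{u}}

lemma mem_mapSpace_triple {m : SimplexCategoryᵒᵖ} {x y z : (X _⦋0⦌) _⦋0⦌} (s : (X _⦋2⦌).obj m)
    (h₂ : (X.δ 2).app m s ∈ (X.mapSpace ![x, y]).obj m)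
    (h₀ : (X.δ 0).app m s ∈ (X.mapSpace ![y, z]).obj m) :
    s ∈ (X.mapSpace ![x, y, z]).obj m := by
  apply mem_mapSpace_of_principal
  intro i
  fin_cases i
  · dsimp
    rw [principal_two_zero]
    exact h₂
  · dsimp
    rw [principal_two_one]
    exact h₀

lemma composable_two {m : SimplexCategoryᵒᵖ} {x y z : (X _⦋0⦌) _⦋0⦌}
    (f : (X.mapSpace ![x, y] : SSet.{u}).obj m) (g : (X.mapSpace ![y, z] : SSet.{u}).obj m)
    (i j : Fin 2) (h : j.val = i.val + 1) :
    (X.δ 0).app m ((![f.1, g.1] : Fin 2 → _) i) = (X.δ 1).app m ((![f.1, g.1] : Fin 2 → _) j) := by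
  obtain rfl : i = 0 := by omega
  obtain rfl : j = 1 := by omega
  exact ((mem_mapSpace_pair _).1 f.2).2.trans ((mem_mapSpace_pair _).1 g.2).1.symm

/-- The vertex `s_{0, •} x` of `X(x, x)`. -/
def idVertex (X : BisimplicialSet.{u}) (x : (X _⦋0⦌) _⦋0⦌) :
    (X.mapSpace ![x, x] : SSet.{u}) _⦋0⦌ :=
  ⟨(X.σ 0).app _ x, (mem_mapSpace_pair _).2 (by
    have h₁ : (X.σ 0 ≫ X.δ 1).app (op ⦋0⦌) x = x := by
      rw [X.δ_comp_σ_succ' (i := 0) (j := 1) rfl]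
      rfl
    have h₀ : (X.σ 0 ≫ X.δ 0).app (op ⦋0⦌) x = x := by
      rw [X.δ_comp_σ_self' (i := 0) (j := 0) rfl]
      rfl
    rw [constAt_zero]
    exact ⟨h₁, h₀⟩)⟩


lemma mapSpaceMap_app_comp {m : SimplexCategoryᵒᵖ} {n k l : ℕ} (θ : ⦋k⦌ ⟶ ⦋n⦌) (η : ⦋l⦌ ⟶ ⦋k⦌)
    {x : Fin (n + 1) → (X _⦋0⦌) _⦋0⦌} {y : Fin (k + 1) → (X _⦋0⦌) _⦋0⦌}
    {z : Fin (l + 1) → (X _⦋0⦌) _⦋0⦌} (h : ∀ i, x (θ.toOrderHom i) = y i)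
    (h' : ∀ i, y (η.toOrderHom i) = z i) (s : (X.mapSpace x : SSet.{u}).obj m) :
    ((X.mapSpaceMap η h').app m ((X.mapSpaceMap θ h).app m s)).1 =
      (X.map (η ≫ θ).op).app m s.1 :=
  map_app_comp X η θ s.1

variable [hX : X.IsSegalSpace]

lemma exists_composite {x y z : (X _⦋0⦌) _⦋0⦌} (f : (X.mapSpace ![x, y] : SSet.{u}) _⦋0⦌)
    (g : (X.mapSpace ![y, z] : SSet.{u}) _⦋0⦌) :
    ∃ T : (X.mapSpace ![x, y, z] : SSet.{u}) _⦋0⦌,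
      (X.face₂ x y z).app _ T = f ∧ (X.face₀ x y z).app _ T = g := by
  obtain ⟨T, hT⟩ := hX.exists_vertex (n := 1) ![f.1, g.1] (composable_two f g)
  have h₂ : (X.δ 2).app _ T = f.1 := by
    rw [← principal_two_zero]
    exact hT 0
  have h₀ : (X.δ 0).app _ T = g.1 := by
    rw [← principal_two_one]
    exact hT 1
  exact ⟨⟨T, mem_mapSpace_triple T (h₂ ▸ f.2) (h₀ ▸ g.2)⟩, Subtype.ext h₂, Subtype.ext h₀⟩

lemma mk_eq_of_edges {x y z : (X _⦋0⦌) _⦋0⦌} (T T' : (X.mapSpace ![x, y, z] : SSet.{u}) _⦋0⦌)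
    (β₀ : SSet.Edge ((X.face₂ x y z).app _ T) ((X.face₂ x y z).app _ T'))
    (β₁ : SSet.Edge ((X.face₀ x y z).app _ T) ((X.face₀ x y z).app _ T')) :
    π₀.mk T = π₀.mk T' := by
  obtain ⟨ε, a₁, a₀, a⟩ := hX.exists_edge (n := 1) T.1 T'.1 ![β₀.edge.1, β₁.edge.1]
    (composable_two β₀.edge β₁.edge)
    (by
      intro i
      fin_cases i
      · dsimp
        rw [principal_two_zero]
        exact congr_arg Subtype.val β₀.src_eq
      · dsimp
        rw [principal_two_one]
        exact congr_arg Subtype.val β₁.src_eq)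
    (by
      intro i
      fin_cases i
      · dsimp
        rw [principal_two_zero]
        exact congr_arg Subtype.val β₀.tgt_eq
      · dsimp
        rw [principal_two_one]
        exact congr_arg Subtype.val β₁.tgt_eq)
  have h₂ : (X.δ 2).app _ ε = β₀.edge.1 := by
    rw [← principal_two_zero]
    exact a 0
  have h₀ : (X.δ 0).app _ ε = β₁.edge.1 := by
    rw [← principal_two_one]
    exact a 1
  exact π₀.sound (SSet.Edge.mk ⟨ε, mem_mapSpace_triple ε (h₂ ▸ β₀.edge.2) (h₀ ▸ β₁.edge.2)⟩
    (Subtype.ext a₁) (Subtype.ext a₀))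

lemma mk_eq_of_faces {x y z : (X _⦋0⦌) _⦋0⦌} {T T' : (X.mapSpace ![x, y, z] : SSet.{u}) _⦋0⦌}
    (h₂ : (X.face₂ x y z).app _ T = (X.face₂ x y z).app _ T')
    (h₀ : (X.face₀ x y z).app _ T = (X.face₀ x y z).app _ T') : π₀.mk T = π₀.mk T' :=
  mk_eq_of_edges T T' (h₂ ▸ SSet.Edge.id _) (h₀ ▸ SSet.Edge.id _)

lemma segalπ₀_bijective (x y z : (X _⦋0⦌) _⦋0⦌) : Function.Bijective (X.segalπ₀ x y z) := by
  choose c hc₂ hc₀ using fun (f : (X.mapSpace ![x, y] : SSet.{u}) _⦋0⦌)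
    (g : (X.mapSpace ![y, z] : SSet.{u}) _⦋0⦌) ↦ exists_composite f g
  let L : X.HomSet x y → X.HomSet y z → π₀ (X.mapSpace ![x, y, z] : SSet.{u}) :=
    π₀.lift (fun f ↦ π₀.lift (fun g ↦ π₀.mk (c f g)) (by
      intro g g' e
      refine mk_eq_of_edges _ _ ?_ ?_
      · rw [hc₂, hc₂]
        exact SSet.Edge.id _
      · rw [hc₀, hc₀]
        exact e)) (by
      intro f f' e
      ext t
      induction t with | mk g =>
      refine mk_eq_of_edges _ _ ?_ ?_
      · rw [hc₂, hc₂]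
        exact e
      · rw [hc₀, hc₀]
        exact SSet.Edge.id _)
  refine Function.bijective_iff_has_inverse.2 ⟨fun t ↦ L t.1 t.2, ?_, ?_⟩
  · intro t
    induction t with | mk T =>
    exact mk_eq_of_faces (hc₂ _ _) (hc₀ _ _)
  · rintro ⟨s, t⟩
    obtain ⟨f, rfl⟩ := π₀.mk_surjective s
    obtain ⟨g, rfl⟩ := π₀.mk_surjective t
    exact Prod.ext (congr_arg π₀.mk (hc₂ f g)) (congr_arg π₀.mk (hc₀ f g))

/-- Composition in `Ho X`: the map
`π₀ X(x, y) × π₀ X(y, z) ≅ π₀ X(x, y, z) → π₀ X(x, z)`, where the bijection is `segalπ₀` and the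
second map is induced by `d_{1, •}`. -/
noncomputable def comp {x y z : (X _⦋0⦌) _⦋0⦌} (p : X.HomSet x y) (q : X.HomSet y z) :
    X.HomSet x z :=
  mapπ₀ (X.face₁ x y z) ((Equiv.ofBijective _ (segalπ₀_bijective x y z)).symm (p, q))

lemma comp_mk {x y z : (X _⦋0⦌) _⦋0⦌} (T : (X.mapSpace ![x, y, z] : SSet.{u}) _⦋0⦌) :
    comp (π₀.mk ((X.face₂ x y z).app _ T)) (π₀.mk ((X.face₀ x y z).app _ T)) =
      π₀.mk ((X.face₁ x y z).app _ T) := by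
  have : (Equiv.ofBijective _ (segalπ₀_bijective x y z)).symm
      (π₀.mk ((X.face₂ x y z).app _ T), π₀.mk ((X.face₀ x y z).app _ T)) = π₀.mk T :=
    (Equiv.symm_apply_eq _).2 rfl
  rw [comp, this]
  rfl

lemma id_comp_mk {x y : (X _⦋0⦌) _⦋0⦌} (f : (X.mapSpace ![x, y] : SSet.{u}) _⦋0⦌) :
    comp (π₀.mk (X.idVertex x)) (π₀.mk f) = π₀.mk f := by
  have hσ : ∀ i, (![x, y] : Fin 2 → _) ((SimplexCategory.σ (0 : Fin 2)).toOrderHom i) =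
    (![x, x, y] : Fin 3 → _) i := by intro i; fin_cases i <;> rfl
  have key := comp_mk ((X.mapSpaceMap (SimplexCategory.σ (0 : Fin 2)) hσ).app _ f)
  have h₂ : (X.face₂ x x y).app _ ((X.mapSpaceMap (SimplexCategory.σ (0 : Fin 2)) hσ).app _ f) =
      X.idVertex x := by
    apply Subtype.ext
    refine (mapSpaceMap_app_comp _ _ _ _ f).trans ?_
    have e : SimplexCategory.δ (2 : Fin 3) ≫ SimplexCategory.σ (0 : Fin 2) =
      SimplexCategory.σ (0 : Fin 1) ≫ SimplexCategory.δ (1 : Fin 2) := by decide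
    rw [e]
    refine (map_app_comp X _ _ f.1).symm.trans ?_
    have := ((mem_mapSpace_pair _).1 f.2).1
    rw [constAt_zero] at this
    exact congr_arg ((X.σ 0).app _) this
  have h₀ : (X.face₀ x x y).app _ ((X.mapSpaceMap (SimplexCategory.σ (0 : Fin 2)) hσ).app _ f) =
      f := by
    apply Subtype.ext
    refine (mapSpaceMap_app_comp _ _ _ _ f).trans ?_
    have e : SimplexCategory.δ (0 : Fin 3) ≫ SimplexCategory.σ (0 : Fin 2) = 𝟙 _ := by decide
    rw [e, op_id, X.map_id]
    rfl
  have h₁ : (X.face₁ x x y).app _ ((X.mapSpaceMap (SimplexCategory.σ (0 : Fin 2)) hσ).app _ f) =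
      f := by
    apply Subtype.ext
    refine (mapSpaceMap_app_comp _ _ _ _ f).trans ?_
    have e : SimplexCategory.δ (1 : Fin 3) ≫ SimplexCategory.σ (0 : Fin 2) = 𝟙 _ := by decide
    rw [e, op_id, X.map_id]
    rfl
  rwa [h₂, h₀, h₁] at key

lemma comp_id_mk {x y : (X _⦋0⦌) _⦋0⦌} (f : (X.mapSpace ![x, y] : SSet.{u}) _⦋0⦌) :
    comp (π₀.mk f) (π₀.mk (X.idVertex y)) = π₀.mk f := by
  have hσ : ∀ i, (![x, y] : Fin 2 → _) ((SimplexCategory.σ (1 : Fin 2)).toOrderHom i) =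
    (![x, y, y] : Fin 3 → _) i := by intro i; fin_cases i <;> rfl
  have key := comp_mk ((X.mapSpaceMap (SimplexCategory.σ (1 : Fin 2)) hσ).app _ f)
  have h₀ : (X.face₀ x y y).app _ ((X.mapSpaceMap (SimplexCategory.σ (1 : Fin 2)) hσ).app _ f) =
      X.idVertex y := by
    apply Subtype.ext
    refine (mapSpaceMap_app_comp _ _ _ _ f).trans ?_
    have e : SimplexCategory.δ (0 : Fin 3) ≫ SimplexCategory.σ (1 : Fin 2) =
      SimplexCategory.σ (0 : Fin 1) ≫ SimplexCategory.δ (0 : Fin 2) := by decide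
    rw [e]
    refine (map_app_comp X _ _ f.1).symm.trans ?_
    have := ((mem_mapSpace_pair _).1 f.2).2
    rw [constAt_zero] at this
    exact congr_arg ((X.σ 0).app _) this
  have h₂ : (X.face₂ x y y).app _ ((X.mapSpaceMap (SimplexCategory.σ (1 : Fin 2)) hσ).app _ f) =
      f := by
    apply Subtype.ext
    refine (mapSpaceMap_app_comp _ _ _ _ f).trans ?_
    have e : SimplexCategory.δ (2 : Fin 3) ≫ SimplexCategory.σ (1 : Fin 2) = 𝟙 _ := by decide
    rw [e, op_id, X.map_id]
    rfl
  have h₁ : (X.face₁ x y y).app _ ((X.mapSpaceMap (SimplexCategory.σ (1 : Fin 2)) hσ).app _ f) =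
      f := by
    apply Subtype.ext
    refine (mapSpaceMap_app_comp _ _ _ _ f).trans ?_
    have e : SimplexCategory.δ (1 : Fin 3) ≫ SimplexCategory.σ (1 : Fin 2) = 𝟙 _ := by decide
    rw [e, op_id, X.map_id]
    rfl
  rwa [h₂, h₀, h₁] at key

lemma exists_triple_composite {w x y z : (X _⦋0⦌) _⦋0⦌}
    (f : (X.mapSpace ![w, x] : SSet.{u}) _⦋0⦌) (g : (X.mapSpace ![x, y] : SSet.{u}) _⦋0⦌)
    (h : (X.mapSpace ![y, z] : SSet.{u}) _⦋0⦌) :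
    ∃ T : (X.mapSpace ![w, x, y, z] : SSet.{u}) _⦋0⦌,
      (X.principal 0).app _ T.1 = f.1 ∧ (X.principal 1).app _ T.1 = g.1 ∧
        (X.principal 2).app _ T.1 = h.1 := by
  obtain ⟨T, hT⟩ := hX.exists_vertex (n := 2) ![f.1, g.1, h.1] (by
    intro i j hij
    fin_cases i
    · obtain rfl : j = 1 := Fin.ext hij
      exact ((mem_mapSpace_pair _).1 f.2).2.trans ((mem_mapSpace_pair _).1 g.2).1.symm
    · obtain rfl : j = 2 := Fin.ext hij
      exact ((mem_mapSpace_pair _).1 g.2).2.trans ((mem_mapSpace_pair _).1 h.2).1.symm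
    · exact absurd hij (by dsimp; omega))
  refine ⟨⟨T, mem_mapSpace_of_principal T ?_⟩, hT 0, hT 1, hT 2⟩
  intro i
  rw [hT]
  fin_cases i
  · exact f.2
  · exact g.2
  · exact h.2

lemma comp_assoc_mk {w x y z : (X _⦋0⦌) _⦋0⦌}
    (f : (X.mapSpace ![w, x] : SSet.{u}) _⦋0⦌) (g : (X.mapSpace ![x, y] : SSet.{u}) _⦋0⦌)
    (h : (X.mapSpace ![y, z] : SSet.{u}) _⦋0⦌) :
    comp (comp (π₀.mk f) (π₀.mk g)) (π₀.mk h) = comp (π₀.mk f) (comp (π₀.mk g) (π₀.mk h)) := by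
  obtain ⟨T, hf, hg, hh⟩ := exists_triple_composite f g h
  have d₃ : ∀ i, (![w, x, y, z] : Fin 4 → _) ((SimplexCategory.δ (3 : Fin 4)).toOrderHom i) =
    (![w, x, y] : Fin 3 → _) i := by intro i; fin_cases i <;> rfl
  have d₂ : ∀ i, (![w, x, y, z] : Fin 4 → _) ((SimplexCategory.δ (2 : Fin 4)).toOrderHom i) =
    (![w, x, z] : Fin 3 → _) i := by intro i; fin_cases i <;> rfl
  have d₁ : ∀ i, (![w, x, y, z] : Fin 4 → _) ((SimplexCategory.δ (1 : Fin 4)).toOrderHom i) =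
    (![w, y, z] : Fin 3 → _) i := by intro i; fin_cases i <;> rfl
  have d₀ : ∀ i, (![w, x, y, z] : Fin 4 → _) ((SimplexCategory.δ (0 : Fin 4)).toOrderHom i) =
    (![x, y, z] : Fin 3 → _) i := by intro i; fin_cases i <;> rfl
  have k₃ := comp_mk ((X.mapSpaceMap (SimplexCategory.δ (3 : Fin 4)) d₃).app _ T)
  have k₂ := comp_mk ((X.mapSpaceMap (SimplexCategory.δ (2 : Fin 4)) d₂).app _ T)
  have k₁ := comp_mk ((X.mapSpaceMap (SimplexCategory.δ (1 : Fin 4)) d₁).app _ T)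
  have k₀ := comp_mk ((X.mapSpaceMap (SimplexCategory.δ (0 : Fin 4)) d₀).app _ T)
  have e₃₂ : (X.face₂ w x y).app _ ((X.mapSpaceMap (SimplexCategory.δ (3 : Fin 4)) d₃).app _ T) =
      f := by
    apply Subtype.ext
    rw [← hf]
    refine (mapSpaceMap_app_comp _ _ _ _ T).trans ?_
    exact congr_arg (fun θ : ⦋1⦌ ⟶ ⦋3⦌ ↦ (X.map θ.op).app _ T.1) (by decide)
  have e₃₀ : (X.face₀ w x y).app _ ((X.mapSpaceMap (SimplexCategory.δ (3 : Fin 4)) d₃).app _ T) =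
      g := by
    apply Subtype.ext
    rw [← hg]
    refine (mapSpaceMap_app_comp _ _ _ _ T).trans ?_
    exact congr_arg (fun θ : ⦋1⦌ ⟶ ⦋3⦌ ↦ (X.map θ.op).app _ T.1) (by decide)
  have e₀₂ : (X.face₂ x y z).app _ ((X.mapSpaceMap (SimplexCategory.δ (0 : Fin 4)) d₀).app _ T) =
      g := by
    apply Subtype.ext
    rw [← hg]
    refine (mapSpaceMap_app_comp _ _ _ _ T).trans ?_
    exact congr_arg (fun θ : ⦋1⦌ ⟶ ⦋3⦌ ↦ (X.map θ.op).app _ T.1) (by decide)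
  have e₀₀ : (X.face₀ x y z).app _ ((X.mapSpaceMap (SimplexCategory.δ (0 : Fin 4)) d₀).app _ T) =
      h := by
    apply Subtype.ext
    rw [← hh]
    refine (mapSpaceMap_app_comp _ _ _ _ T).trans ?_
    exact congr_arg (fun θ : ⦋1⦌ ⟶ ⦋3⦌ ↦ (X.map θ.op).app _ T.1) (by decide)
  have e₁₂ : (X.face₂ w y z).app _ ((X.mapSpaceMap (SimplexCategory.δ (1 : Fin 4)) d₁).app _ T) =
      (X.face₁ w x y).app _ ((X.mapSpaceMap (SimplexCategory.δ (3 : Fin 4)) d₃).app _ T) := by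
    apply Subtype.ext
    refine (mapSpaceMap_app_comp _ _ _ _ T).trans
      (Eq.trans ?_ (mapSpaceMap_app_comp _ _ _ _ T).symm)
    exact congr_arg (fun θ : ⦋1⦌ ⟶ ⦋3⦌ ↦ (X.map θ.op).app _ T.1) (by decide)
  have e₁₀ : (X.face₀ w y z).app _ ((X.mapSpaceMap (SimplexCategory.δ (1 : Fin 4)) d₁).app _ T) =
      h := by
    apply Subtype.ext
    rw [← hh]
    refine (mapSpaceMap_app_comp _ _ _ _ T).trans ?_
    exact congr_arg (fun θ : ⦋1⦌ ⟶ ⦋3⦌ ↦ (X.map θ.op).app _ T.1) (by decide)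
  have e₂₂ : (X.face₂ w x z).app _ ((X.mapSpaceMap (SimplexCategory.δ (2 : Fin 4)) d₂).app _ T) =
      f := by
    apply Subtype.ext
    rw [← hf]
    refine (mapSpaceMap_app_comp _ _ _ _ T).trans ?_
    exact congr_arg (fun θ : ⦋1⦌ ⟶ ⦋3⦌ ↦ (X.map θ.op).app _ T.1) (by decide)
  have e₂₀ : (X.face₀ w x z).app _ ((X.mapSpaceMap (SimplexCategory.δ (2 : Fin 4)) d₂).app _ T) =
      (X.face₁ x y z).app _ ((X.mapSpaceMap (SimplexCategory.δ (0 : Fin 4)) d₀).app _ T) := by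
    apply Subtype.ext
    refine (mapSpaceMap_app_comp _ _ _ _ T).trans
      (Eq.trans ?_ (mapSpaceMap_app_comp _ _ _ _ T).symm)
    exact congr_arg (fun θ : ⦋1⦌ ⟶ ⦋3⦌ ↦ (X.map θ.op).app _ T.1) (by decide)
  have e₁₁ : (X.face₁ w y z).app _ ((X.mapSpaceMap (SimplexCategory.δ (1 : Fin 4)) d₁).app _ T) =
      (X.face₁ w x z).app _ ((X.mapSpaceMap (SimplexCategory.δ (2 : Fin 4)) d₂).app _ T) := by
    apply Subtype.ext
    refine (mapSpaceMap_app_comp _ _ _ _ T).trans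
      (Eq.trans ?_ (mapSpaceMap_app_comp _ _ _ _ T).symm)
    exact congr_arg (fun θ : ⦋1⦌ ⟶ ⦋3⦌ ↦ (X.map θ.op).app _ T.1) (by decide)
  rw [e₃₂, e₃₀] at k₃
  rw [e₀₂, e₀₀] at k₀
  rw [e₁₂, e₁₀, e₁₁] at k₁
  rw [e₂₂, e₂₀] at k₂
  rw [k₃, k₁, k₀, k₂]

end

/-- The homotopy category of a Segal space `X`: its objects are the vertices of `X_{0, •}`, its
morphisms `x ⟶ y` are the connected components of `X(x, y)`, identities are the components of the
vertices `s_{0, •} x`, and composition is `comp`. -/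
def Ho (X : BisimplicialSet.{u}) [X.IsSegalSpace] : Type u := (X _⦋0⦌) _⦋0⦌

namespace Ho

variable {X : BisimplicialSet.{u}} [X.IsSegalSpace]

/-- A vertex of `X_{0, •}` as an object of `Ho X`. -/
def of (x : (X _⦋0⦌) _⦋0⦌) : Ho X := x

/-- The vertex of `X_{0, •}` underlying an object of `Ho X`. -/
def vertex (x : Ho X) : (X _⦋0⦌) _⦋0⦌ := x

noncomputable instance : Category.{u} (Ho X) where
  Hom x y := X.HomSet x.vertex y.vertex
  id x := π₀.mk (X.idVertex x.vertex)
  comp f g := comp f g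
  id_comp f := by
    obtain ⟨f, rfl⟩ := π₀.mk_surjective f
    exact id_comp_mk f
  comp_id f := by
    obtain ⟨f, rfl⟩ := π₀.mk_surjective f
    exact comp_id_mk f
  assoc f g h := by
    obtain ⟨f, rfl⟩ := π₀.mk_surjective f
    obtain ⟨g, rfl⟩ := π₀.mk_surjective g
    obtain ⟨h, rfl⟩ := π₀.mk_surjective h
    exact comp_assoc_mk f g h

/-- The morphism of `Ho X` given by the connected component of a vertex of `X(x, y)`. -/
def homMk {x y : (X _⦋0⦌) _⦋0⦌} (f : (X.mapSpace ![x, y] : SSet.{u}) _⦋0⦌) :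
    of (X := X) x ⟶ of y :=
  show X.HomSet x y from π₀.mk f

end Ho

/-- `σ ∈ X_{1, 1}` is a connection for the edge `p` of `X_{0, •}`. -/
structure IsConnection (X : BisimplicialSet.{u}) (p : (X _⦋0⦌) _⦋1⦌) (σ : (X _⦋1⦌) _⦋1⦌) :
    Prop where
  /-- `d_{1, •}(σ) = p` -/
  source_eq : (X.δ 1).app _ σ = p
  /-- `d_{0, •}(σ) = s_{•, 0}(d_{•, 0}(p))` -/
  target_eq : (X.δ 0).app _ σ = (X _⦋0⦌).σ 0 ((X _⦋0⦌).δ 0 p)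
  /-- `d_{•, 0}(σ) = s_{0, •}(d_{•, 0}(p))` -/
  end_eq : (X _⦋1⦌).δ 0 σ = (X.σ 0).app _ ((X _⦋0⦌).δ 0 p)

lemma IsConnection.mem_mapSpace {X : BisimplicialSet.{u}} {x y : (X _⦋0⦌) _⦋0⦌}
    {p : SSet.Edge x y} {σ : (X _⦋1⦌) _⦋1⦌} (h : X.IsConnection p.edge σ) :
    (X _⦋1⦌).δ 1 σ ∈ (X.mapSpace ![x, y]).obj (op ⦋0⦌) := by
  rw [mem_mapSpace_pair, constAt_zero, constAt_zero]
  constructor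
  · refine (ConcreteCategory.congr_hom ((X.δ 1).naturality (SimplexCategory.δ 1).op) σ).trans ?_
    exact (congr_arg ((X _⦋0⦌).δ 1) h.source_eq).trans p.src_eq
  · refine (ConcreteCategory.congr_hom ((X.δ 0).naturality (SimplexCategory.δ 1).op) σ).trans ?_
    refine (congr_arg ((X _⦋0⦌).δ 1) h.target_eq).trans ?_
    rw [p.tgt_eq]
    exact SSet.δ_comp_σ_succ'_apply (S := X _⦋0⦌) (i := (0 : Fin 1)) (j := 1) rfl y

/-- The vertex `d_{•, 1}(σ)` of `X(x, y)`, for a connection `σ` of an edge `p : x → y`. -/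
def IsConnection.vertex {X : BisimplicialSet.{u}} {x y : (X _⦋0⦌) _⦋0⦌}
    {p : SSet.Edge x y} {σ : (X _⦋1⦌) _⦋1⦌} (h : X.IsConnection p.edge σ) :
    (X.mapSpace ![x, y] : SSet.{u}) _⦋0⦌ :=
  ⟨(X _⦋1⦌).δ 1 σ, h.mem_mapSpace⟩

end BisimplicialSet

end SegalSpaces

open SegalSpaces

/-!
Write `∂ : X_{1, •} ⟶ X_{0, •} × X_{0, •}` for the map `(d_{1, •}, d_{0, •})`. By Reedy fibrancy it
is a Kan fibration (`IsReedyFibrant.fibration_matchingMap`, with target in the form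
`M_v(∂Δ[1], X)`), so horns in `X_{1, •}` can be filled over any prescribed simplices of the base
(`IsReedyFibrant.exists_horn_filler`).

A connection for `p : x → y` is a lift along `∂` of the edge `(p, const y)`, ending at the vertex
`s_{0, •} y`; it exists because `Λ[1, 1]` can be filled. Two connections for `p` have the same final
vertex, and filling the resulting `Λ[2, 2]` over `(s₀ p, const y)` joins their initial vertices by
an edge lying over `(const x, const y)`, that is, inside `X(x, y)` (`IsConnection.mk_vertex_eq`).

For functoriality, let `t` be a triangle of `X_{0, •}` with edges `p : x → y`, `q : y → z` and
`r : x → z`, and let `σ : a → s_{0, •} y` and `τ : b → s_{0, •} z` be connections for `p` and `q`.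
A vertex `T` of `X(x, y, z)` with outer faces `a` and `b` has an inner face `c` whose component is
the composite of those of `a` and `b`. By the Segal condition, `T` is joined in `X_{2, •}`
to the degenerate triangle on `b` by an edge with outer faces `σ` and the constant edge at `b`. The inner face of that edge goes from
`c` to `b` and lies over `(p, const z)`; composing it with `τ` by filling `Λ[2, 1]` over
`(t, const z)` gives a connection for `r` starting at `c` (`IsConnection.exists_comp`). Hence
`p ↦ [d_{•, 1} σ]` respects the relations defining `τ₁ (X_{0, •})`. Uniqueness of the functor holds
because `τ₁ (X_{0, •})` is generated by edges.
-/

namespace SegalSpaces.BisimplicialSet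
open SSet modelCategoryQuillen

/-! ### Horns in the first column relative to its two ends -/

lemma boundary_one_toOrderHom_eq {m : SimplexCategoryᵒᵖ} {s : (Δ[1] : SSet.{u}).obj m}
    (hs : s ∈ (∂Δ[1] : (Δ[1] : SSet.{u}).Subcomplex).obj m) (t : Fin (m.unop.len + 1)) :
    (stdSimplex.objEquiv s).toOrderHom t = (stdSimplex.objEquiv s).toOrderHom 0 := by
  obtain ⟨j, hj⟩ := (mem_boundary_iff_notMem_range s).1 hs
  have h₁ : (stdSimplex.objEquiv s).toOrderHom t ≠ j := fun h ↦ hj ⟨t, h⟩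
  have h₂ : (stdSimplex.objEquiv s).toOrderHom 0 ≠ j := fun h ↦ hj ⟨0, h⟩
  simp only [SimplexCategory.len_mk] at *
  omega

/-- The map `∂Δ[1] ⟶ Y` sending the vertices `0` and `1` to `a` and `b`. Every simplex of `∂Δ[1]` is
constant, so its value is read off from its vertex of index `0`. -/
def boundaryOneDesc {Y : SSet.{u}} (a b : Y _⦋0⦌) : (∂Δ[1] : SSet.{u}) ⟶ Y where
  app m := ↾fun s ↦ Y.map (SimplexCategory.const m.unop ⦋0⦌ 0).op
    (if (stdSimplex.objEquiv s.1).toOrderHom 0 = 0 then a else b)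
  naturality m m' θ := by
    ext ⟨s, hs⟩
    change Y.map (SimplexCategory.const m'.unop ⦋0⦌ 0).op
        (if (stdSimplex.objEquiv s).toOrderHom (θ.unop.toOrderHom 0) = 0 then a else b) =
      Y.map θ (Y.map (SimplexCategory.const m.unop ⦋0⦌ 0).op
        (if (stdSimplex.objEquiv s).toOrderHom 0 = 0 then a else b))
    rw [boundary_one_toOrderHom_eq hs, ← Functor.map_comp_apply]
    rfl

lemma boundary_one_ι_comp {Y : SSet.{u}} (s : Y _⦋1⦌) :
    ∂Δ[1].ι ≫ yonedaEquiv.symm s = boundaryOneDesc (Y.δ 1 s) (Y.δ 0 s) := by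
  ext m ⟨t, ht⟩
  change Y.map (stdSimplex.objEquiv t).op s = Y.map (SimplexCategory.const m.unop ⦋0⦌ 0).op
    (if (stdSimplex.objEquiv t).toOrderHom 0 = 0 then Y.δ 1 s else Y.δ 0 s)
  have key := boundary_one_toOrderHom_eq ht
  split_ifs with h
  · have e : stdSimplex.objEquiv t = SimplexCategory.const m.unop ⦋0⦌ 0 ≫ SimplexCategory.δ 1 := by
      ext k : 3
      exact (key k).trans h
    rw [e, op_comp, Functor.map_comp_apply]
    rfl
  · have e : stdSimplex.objEquiv t = SimplexCategory.const m.unop ⦋0⦌ 0 ≫ SimplexCategory.δ 0 := by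
      ext k : 3
      refine (key k).trans ?_
      exact Fin.eq_one_of_ne_zero _ h
    rw [e, op_comp, Functor.map_comp_apply]
    rfl

/-- The identification of the first column of `X` with `M_v(Δ[1], X)`. -/
def columnOneIso (X : BisimplicialSet.{u}) : X _⦋1⦌ ≅ Mv Δ[1] X :=
  NatIso.ofComponents (fun m ↦ Equiv.toIso ⟨toMv, ofMv, ofMv_toMv, toMv_ofMv⟩) (fun θ ↦ by
    ext s
    refine (toMv_ofMv _).symm.trans (Eq.trans ?_ (toMv_ofMv _))
    refine congr_arg toMv ?_
    refine (ofMv_toMv _).trans (Eq.trans ?_ (ofMv_map θ (toMv s)).symm)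
    rw [ofMv_toMv]
    rfl)

/-- The first column of `X`, mapped to the matching object `M_v(∂Δ[1], X) ≅ X_{0, •} × X_{0, •}`. -/
def matchingMap (X : BisimplicialSet.{u}) : X _⦋1⦌ ⟶ Mv ∂Δ[1] X :=
  X.columnOneIso.hom ≫ MvMap ∂Δ[1].ι X

lemma IsReedyFibrant.fibration_matchingMap {X : BisimplicialSet.{u}} (hX : X.IsReedyFibrant) :
    Fibration X.matchingMap := by
  have := hX 1
  dsimp only [matchingMap]
  infer_instance

lemma matchingMap_app {X : BisimplicialSet.{u}} {m : SimplexCategoryᵒᵖ} (s : (X _⦋1⦌).obj m) :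
    X.matchingMap.app m s = boundaryOneDesc (Y := X.transpose.obj m)
      ((X.δ 1).app m s) ((X.δ 0).app m s) :=
  boundary_one_ι_comp (Y := X.transpose.obj m) s

lemma boundaryOneDesc_zero {Y : SSet.{u}} (a b : Y _⦋0⦌) :
    (boundaryOneDesc a b).app (op ⦋0⦌) ⟨stdSimplex.obj₀Equiv.symm 0, by
      simp [boundary_obj_eq_univ 0 1]⟩ = a := by
  change Y.map (SimplexCategory.const ⦋0⦌ ⦋0⦌ 0).op a = a
  rw [SimplexCategory.const_eq_id]
  simp

lemma boundaryOneDesc_one {Y : SSet.{u}} (a b : Y _⦋0⦌) :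
    (boundaryOneDesc a b).app (op ⦋0⦌) ⟨stdSimplex.obj₀Equiv.symm 1, by
      simp [boundary_obj_eq_univ 0 1]⟩ = b := by
  change Y.map (SimplexCategory.const ⦋0⦌ ⦋0⦌ 0).op b = b
  rw [SimplexCategory.const_eq_id]
  simp

lemma boundaryOneDesc_inj {Y : SSet.{u}} {a b a' b' : Y _⦋0⦌}
    (h : boundaryOneDesc a b = boundaryOneDesc a' b') : a = a' ∧ b = b' :=
  ⟨by rw [← boundaryOneDesc_zero a b, h, boundaryOneDesc_zero],
    by rw [← boundaryOneDesc_one a b, h, boundaryOneDesc_one]⟩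

lemma map_boundaryOneDesc {X : BisimplicialSet.{u}} {m m' : SimplexCategoryᵒᵖ} (θ : m ⟶ m')
    (u v : (X _⦋0⦌).obj m) :
    (Mv ∂Δ[1] X).map θ (boundaryOneDesc (Y := X.transpose.obj m) u v) =
      boundaryOneDesc (Y := X.transpose.obj m') ((X _⦋0⦌).map θ u) ((X _⦋0⦌).map θ v) := by
  change boundaryOneDesc (Y := X.transpose.obj m) u v ≫ X.transpose.map θ = _
  ext k ⟨s, hs⟩
  refine (ConcreteCategory.congr_hom ((X.transpose.map θ).naturality
    (SimplexCategory.const k.unop ⦋0⦌ 0).op) (if (stdSimplex.objEquiv s).toOrderHom 0 = 0 then u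
      else v)).trans ?_
  exact congr_arg ((X.transpose.obj m').map _)
    (apply_ite ((X _⦋0⦌).map θ) ((stdSimplex.objEquiv s).toOrderHom 0 = 0) u v)

/-- Horns in the first column can be filled over any prescribed pair of ends. -/
lemma IsReedyFibrant.exists_horn_filler {X : BisimplicialSet.{u}} (hX : X.IsReedyFibrant)
    {n : ℕ} {i : Fin (n + 2)} (f : ∀ (j : Fin (n + 2)) (_ : j ≠ i), (X _⦋1⦌) _⦋n⦌)
    (hf : horn.IsCompatible (fun j hj ↦ yonedaEquiv.symm (f j hj)))
    (u v : (X _⦋0⦌) _⦋n + 1⦌)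
    (hu : ∀ j hj, (X.δ 1).app _ (f j hj) = (X _⦋0⦌).δ j u)
    (hv : ∀ j hj, (X.δ 0).app _ (f j hj) = (X _⦋0⦌).δ j v) :
    ∃ s : (X _⦋1⦌) _⦋n + 1⦌, (∀ j, j ≠ i → ∀ hj, (X _⦋1⦌).δ j s = f j hj) ∧
      (X.δ 1).app _ s = u ∧ (X.δ 0).app _ s = v := by
  have := hX.fibration_matchingMap
  let b : (Mv ∂Δ[1] X) _⦋n + 1⦌ := boundaryOneDesc (Y := X.transpose.obj (op ⦋n + 1⦌)) u v
  obtain ⟨φ, h₁, h₂⟩ := hf.exists_lift X.matchingMap (yonedaEquiv.symm b) (fun j hj ↦ by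
    rw [stdSimplex.δ_comp_yonedaEquiv_symm, yonedaEquiv_symm_comp, matchingMap_app, hu, hv]
    exact congr_arg yonedaEquiv.symm (map_boundaryOneDesc _ u v).symm)
  obtain ⟨s, rfl⟩ := yonedaEquiv.symm.surjective φ
  refine ⟨s, fun j _ hj ↦ ?_, boundaryOneDesc_inj (Y := X.transpose.obj (op ⦋n + 1⦌)) ?_⟩
  · apply yonedaEquiv.symm.injective
    rw [← stdSimplex.δ_comp_yonedaEquiv_symm, h₁ j hj]
  · rw [← matchingMap_app]
    apply yonedaEquiv.symm.injective
    rw [← yonedaEquiv_symm_comp, h₂]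

lemma IsReedyFibrant.exists_edge_of_end {X : BisimplicialSet.{u}} (hX : X.IsReedyFibrant)
    (u v : (X _⦋0⦌) _⦋1⦌) (b : (X _⦋1⦌) _⦋0⦌) (hu : (X.δ 1).app _ b = (X _⦋0⦌).δ 0 u)
    (hv : (X.δ 0).app _ b = (X _⦋0⦌).δ 0 v) :
    ∃ s : (X _⦋1⦌) _⦋1⦌, (X.δ 1).app _ s = u ∧ (X.δ 0).app _ s = v ∧ (X _⦋1⦌).δ 0 s = b := by
  obtain ⟨s, hs, h₁, h₀⟩ := hX.exists_horn_filler (n := 0) (i := 1) (fun _ _ ↦ b) (by simp) u v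
    (fun j hj ↦ by obtain rfl : j = 0 := by grind
                   exact hu)
    (fun j hj ↦ by obtain rfl : j = 0 := by grind
                   exact hv)
  exact ⟨s, h₁, h₀, hs 0 (by simp) (by simp)⟩

/-- Filling of horns `Λ[2, 2]` in the first column over prescribed ends. -/
lemma IsReedyFibrant.exists_fill_two {X : BisimplicialSet.{u}} (hX : X.IsReedyFibrant)
    (u v : (X _⦋0⦌) _⦋2⦌) (a₀ a₁ : (X _⦋1⦌) _⦋1⦌) (h : (X _⦋1⦌).δ 0 a₀ = (X _⦋1⦌).δ 0 a₁)
    (hu₀ : (X.δ 1).app _ a₀ = (X _⦋0⦌).δ 0 u) (hu₁ : (X.δ 1).app _ a₁ = (X _⦋0⦌).δ 1 u)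
    (hv₀ : (X.δ 0).app _ a₀ = (X _⦋0⦌).δ 0 v) (hv₁ : (X.δ 0).app _ a₁ = (X _⦋0⦌).δ 1 v) :
    ∃ s : (X _⦋1⦌) _⦋2⦌, (X.δ 1).app _ s = u ∧ (X.δ 0).app _ s = v ∧
      (X _⦋1⦌).δ 0 s = a₀ ∧ (X _⦋1⦌).δ 1 s = a₁ := by
  obtain ⟨s, hs, h₁, h₀⟩ := hX.exists_horn_filler (n := 1) (i := 2)
    (fun j _ ↦ if j = 0 then a₀ else a₁) (by
      rw [horn.isCompatible_iff]
      intro j k hj hk hjk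
      obtain rfl : j = 0 := by grind
      obtain rfl : k = 1 := by grind
      rw [stdSimplex.δ_comp_yonedaEquiv_symm, stdSimplex.δ_comp_yonedaEquiv_symm]
      exact congr_arg _ h) u v
    (fun j hj ↦ by
      obtain rfl | rfl : j = 0 ∨ j = 1 := by grind
      · exact hu₀
      · exact hu₁)
    (fun j hj ↦ by
      obtain rfl | rfl : j = 0 ∨ j = 1 := by grind
      · exact hv₀
      · exact hv₁)
  exact ⟨s, h₁, h₀, hs 0 (by simp) (by simp), hs 1 (by simp) (by simp)⟩

/-- Filling of horns `Λ[2, 1]` in the first column over prescribed ends. -/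
lemma IsReedyFibrant.exists_fill_one {X : BisimplicialSet.{u}} (hX : X.IsReedyFibrant)
    (u v : (X _⦋0⦌) _⦋2⦌) (a₀ a₂ : (X _⦋1⦌) _⦋1⦌) (h : (X _⦋1⦌).δ 1 a₀ = (X _⦋1⦌).δ 0 a₂)
    (hu₀ : (X.δ 1).app _ a₀ = (X _⦋0⦌).δ 0 u) (hu₂ : (X.δ 1).app _ a₂ = (X _⦋0⦌).δ 2 u)
    (hv₀ : (X.δ 0).app _ a₀ = (X _⦋0⦌).δ 0 v) (hv₂ : (X.δ 0).app _ a₂ = (X _⦋0⦌).δ 2 v) :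
    ∃ s : (X _⦋1⦌) _⦋2⦌, (X.δ 1).app _ s = u ∧ (X.δ 0).app _ s = v ∧
      (X _⦋1⦌).δ 0 s = a₀ ∧ (X _⦋1⦌).δ 2 s = a₂ := by
  obtain ⟨s, hs, h₁, h₀⟩ := hX.exists_horn_filler (n := 1) (i := 1)
    (fun j _ ↦ if j = 0 then a₀ else a₂) (by
      rw [horn.isCompatible_iff]
      intro j k hj hk hjk
      obtain rfl : j = 0 := by grind
      obtain rfl : k = 2 := by grind
      rw [stdSimplex.δ_comp_yonedaEquiv_symm, stdSimplex.δ_comp_yonedaEquiv_symm]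
      exact congr_arg _ h) u v
    (fun j hj ↦ by
      obtain rfl | rfl : j = 0 ∨ j = 2 := by grind
      · exact hu₀
      · exact hu₂)
    (fun j hj ↦ by
      obtain rfl | rfl : j = 0 ∨ j = 2 := by grind
      · exact hv₀
      · exact hv₂)
  exact ⟨s, h₁, h₀, hs 0 (by simp) (by simp), hs 2 (by simp) (by simp)⟩

lemma δ_zero_σ_zero {Y : SSet.{u}} {n : ℕ} (y : Y _⦋n⦌) : Y.δ 0 (Y.σ 0 y) = y :=
  δ_comp_σ_self'_apply (S := Y) (i := (0 : Fin (n + 1))) (j := 0) rfl y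

lemma δ_one_σ_zero {Y : SSet.{u}} {n : ℕ} (y : Y _⦋n⦌) : Y.δ 1 (Y.σ 0 y) = y :=
  δ_comp_σ_succ'_apply (S := Y) (i := (0 : Fin (n + 1))) (j := 1) rfl y

lemma δ_two_σ_zero {Y : SSet.{u}} (e : Y _⦋1⦌) : Y.δ 2 (Y.σ 0 e) = Y.σ 0 (Y.δ 1 e) :=
  δ_comp_σ_of_gt_apply (S := Y) (i := 1) (j := 0) (by simp) e

lemma constAt_one (X : BisimplicialSet.{u}) (x : (X _⦋0⦌) _⦋0⦌) :
    X.constAt (op ⦋1⦌) x = (X _⦋0⦌).σ 0 x :=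
  congr_arg (fun f : ⦋1⦌ ⟶ ⦋0⦌ ↦ (X _⦋0⦌).map f.op x) (Subsingleton.elim _ _)

/-! ### Connections -/

section

variable {X : BisimplicialSet.{u}}

lemma mapSpace_vertex_ends {x y : (X _⦋0⦌) _⦋0⦌} (f : (X.mapSpace ![x, y] : SSet.{u}) _⦋0⦌) :
    (X.δ 1).app _ f.1 = x ∧ (X.δ 0).app _ f.1 = y := by
  have := (mem_mapSpace_pair _).1 f.2
  rwa [constAt_zero, constAt_zero] at this

lemma IsReedyFibrant.exists_isConnection (hX : X.IsReedyFibrant) (p : (X _⦋0⦌) _⦋1⦌) :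
    ∃ σ, X.IsConnection p σ := by
  have hy := mapSpace_vertex_ends (X.idVertex ((X _⦋0⦌).δ 0 p))
  obtain ⟨s, h₁, h₀, hs⟩ := hX.exists_edge_of_end p ((X _⦋0⦌).σ 0 ((X _⦋0⦌).δ 0 p))
    ((X.σ 0).app _ ((X _⦋0⦌).δ 0 p)) hy.1 (hy.2.trans (δ_zero_σ_zero _).symm)
  exact ⟨s, h₁, h₀, hs⟩

/-- Two connections for the same edge form a horn `Λ[2, 2]` over a degenerate triangle; the missing
face of a filler joins their initial vertices inside the mapping space. -/
lemma IsConnection.mk_vertex_eq (hX : X.IsReedyFibrant) {x y : (X _⦋0⦌) _⦋0⦌} {p : SSet.Edge x y}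
    {σ σ' : (X _⦋1⦌) _⦋1⦌} (h : X.IsConnection p.edge σ) (h' : X.IsConnection p.edge σ') :
    π₀.mk h.vertex = π₀.mk h'.vertex := by
  obtain ⟨s, h₁, h₀, hs₀, hs₁⟩ := hX.exists_fill_two ((X _⦋0⦌).σ 0 p.edge)
    ((X _⦋0⦌).σ 0 ((X _⦋0⦌).σ 0 y)) σ' σ (h'.end_eq.trans h.end_eq.symm)
    (by rw [h'.source_eq, δ_zero_σ_zero]) (by rw [h.source_eq, δ_one_σ_zero])
    (by rw [h'.target_eq, p.tgt_eq, δ_zero_σ_zero]) (by rw [h.target_eq, p.tgt_eq, δ_one_σ_zero])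
  refine π₀.sound (SSet.Edge.mk ⟨(X _⦋1⦌).δ 2 s, ?_⟩ (Subtype.ext ?_) (Subtype.ext ?_))
  · rw [mem_mapSpace_pair, constAt_one, constAt_one]
    refine ⟨((X.δ 1).naturality_apply _ s).trans ?_, ((X.δ 0).naturality_apply _ s).trans ?_⟩
    · rw [h₁]
      exact (δ_two_σ_zero _).trans (by rw [p.src_eq])
    · rw [h₀]
      exact (δ_two_σ_zero _).trans (by rw [δ_one_σ_zero])
  · exact (δ_comp_δ_apply (S := X _⦋1⦌) (i := 1) (j := 1) (by simp) s).trans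
      (congr_arg _ hs₁)
  · exact (δ_comp_δ_apply (S := X _⦋1⦌) (i := 0) (j := 1) (by simp) s).trans
      (congr_arg _ hs₀)

lemma isConnection_id (x : (X _⦋0⦌) _⦋0⦌) :
    X.IsConnection (SSet.Edge.id x).edge ((X _⦋1⦌).σ 0 ((X.σ 0).app _ x)) where
  source_eq := ((X.δ 1).naturality_apply _ _).trans
    (congr_arg ((X _⦋0⦌).σ 0) (mapSpace_vertex_ends (X.idVertex x)).1)
  target_eq := ((X.δ 0).naturality_apply _ _).trans (by
    rw [(SSet.Edge.id x).tgt_eq]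
    exact congr_arg ((X _⦋0⦌).σ 0) (mapSpace_vertex_ends (X.idVertex x)).2)
  end_eq := by
    rw [δ_zero_σ_zero, (SSet.Edge.id x).tgt_eq]

lemma isConnection_id_vertex (x : (X _⦋0⦌) _⦋0⦌) :
    (isConnection_id x).vertex = X.idVertex x :=
  Subtype.ext (δ_one_σ_zero _)

/-- If a triangle of `X_{0, •}` has edges `p`, `q`, `r` and `T` is a vertex of `X(x, y, z)` whose
outer faces are the initial vertices of connections for `p` and `q`, then the inner face of `T` is
the initial vertex of a connection for `r`. -/
lemma IsConnection.exists_comp [hX : X.IsSegalSpace] {x y z : (X _⦋0⦌) _⦋0⦌} {p : SSet.Edge x y}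
    {q : SSet.Edge y z} {r : SSet.Edge x z} (t : SSet.Edge.CompStruct p q r)
    {σ τ : (X _⦋1⦌) _⦋1⦌} (hσ : X.IsConnection p.edge σ) (hτ : X.IsConnection q.edge τ)
    (T : (X.mapSpace ![x, y, z] : SSet.{u}) _⦋0⦌) (hT₂ : (X.face₂ x y z).app _ T = hσ.vertex)
    (hT₀ : (X.face₀ x y z).app _ T = hτ.vertex) :
    ∃ (ρ : (X _⦋1⦌) _⦋1⦌) (hρ : X.IsConnection r.edge ρ),
      hρ.vertex = (X.face₁ x y z).app _ T := by
  obtain ⟨hb₁, hb₀⟩ := mapSpace_vertex_ends hτ.vertex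
  have hT₂' : (X.δ 2).app _ T.1 = (X _⦋1⦌).δ 1 σ := congr_arg Subtype.val hT₂
  have hT₀' : (X.δ 0).app _ T.1 = hτ.vertex.1 := congr_arg Subtype.val hT₀
  generalize hb : hτ.vertex.1 = b at hb₁ hb₀ hT₀'
  change (X _⦋1⦌).δ 1 τ = b at hb
  have hσb : ∀ i, (X.δ i).app _ ((X _⦋1⦌).σ 0 b) = (X _⦋0⦌).σ 0 ((X.δ i).app _ b) := fun i ↦
    (X.δ i).naturality_apply _ b
  -- The edge of `X_{2, •}` from `T` to the degenerate triangle on `b` whose outer faces are `σ` and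
  -- the constant edge at `b`; its inner face is an edge from the inner face of `T` to `b` over `p`.
  obtain ⟨ε, hε₁, hε₀, hε⟩ := hX.exists_edge (n := 1) T.1 ((X.σ 0).app _ b)
    ![σ, (X _⦋1⦌).σ 0 b]
    (by
      intro i j hij
      obtain rfl : i = 0 := by grind
      obtain rfl : j = 1 := by grind
      change (X.δ 0).app _ σ = (X.δ 1).app _ ((X _⦋1⦌).σ 0 b)
      rw [hσ.target_eq, p.tgt_eq, hσb, hb₁])
    (by
      intro i
      fin_cases i
      · dsimp
        rw [principal_two_zero, hT₂']
      · dsimp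
        rw [principal_two_one, hT₀', δ_one_σ_zero])
    (by
      intro i
      fin_cases i
      · dsimp
        rw [principal_two_zero, hσ.end_eq, p.tgt_eq, ← hb₁]
        exact (ConcreteCategory.congr_hom (NatTrans.congr_app
          (X.δ_comp_σ_of_gt (i := 1) (j := 0) (by simp)) _) b).symm
      · dsimp
        rw [principal_two_one, δ_zero_σ_zero]
        exact (ConcreteCategory.congr_hom (NatTrans.congr_app
          (X.δ_comp_σ_self' (i := 0) (j := 0) rfl) _) b).symm)
  have hε₂' : (X.δ 2).app _ ε = σ := by
    rw [← principal_two_zero]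
    exact hε 0
  have hε₀' : (X.δ 0).app _ ε = (X _⦋1⦌).σ 0 b := by
    rw [← principal_two_one]
    exact hε 1
  -- That edge is composed with `τ` by filling a horn `Λ[2, 1]` over the triangle `t`.
  obtain ⟨s, h₁, h₀, hs₀, hs₂⟩ := hX.isReedyFibrant.exists_fill_one t.simplex
    ((X _⦋0⦌).σ 0 ((X _⦋0⦌).σ 0 z)) τ ((X.δ 1).app _ ε)
    (by
      rw [hb]
      refine Eq.trans ?_ ((X.δ 1).naturality_apply (SimplexCategory.δ 0).op ε)
      refine Eq.trans ?_ (congr_arg ((X.δ 1).app _) hε₀.symm)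
      exact (ConcreteCategory.congr_hom (NatTrans.congr_app
          (X.δ_comp_σ_succ' (i := 0) (j := 1) rfl) _) b).symm)
    (by rw [hτ.source_eq, t.d₀])
    (by
      rw [t.d₂, ← hσ.source_eq, ← hε₂']
      exact (ConcreteCategory.congr_hom (NatTrans.congr_app
          (X.δ_comp_δ (i := 1) (j := 1) (by simp)) _) ε).symm)
    (by rw [hτ.target_eq, q.tgt_eq, δ_zero_σ_zero])
    (by
      rw [δ_two_σ_zero, δ_one_σ_zero, ← hb₀, ← hσb, ← hε₀']
      exact ConcreteCategory.congr_hom (NatTrans.congr_app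
          (X.δ_comp_δ (i := 0) (j := 0) (by simp)) _) ε)
  refine ⟨(X _⦋1⦌).δ 1 s, ⟨?_, ?_, ?_⟩, Subtype.ext ?_⟩
  · refine ((X.δ 1).naturality_apply _ s).trans ?_
    rw [h₁]
    exact t.d₁
  · refine ((X.δ 0).naturality_apply _ s).trans ?_
    rw [h₀, r.tgt_eq]
    exact δ_one_σ_zero _
  · refine (δ_comp_δ_apply (S := X _⦋1⦌) (i := 0) (j := 0) (by simp) s).trans ?_
    refine (congr_arg _ hs₀).trans ?_
    rw [hτ.end_eq, q.tgt_eq, r.tgt_eq]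
  · refine (δ_comp_δ_apply (S := X _⦋1⦌) (i := 1) (j := 1) (by simp) s).symm.trans ?_
    refine (congr_arg _ hs₂).trans ?_
    refine ((X.δ 1).naturality_apply _ ε).symm.trans ?_
    exact congr_arg ((X.δ 1).app _) hε₁

end

/-! ### The functor to the homotopy category -/

variable {X : BisimplicialSet.{u}} [hX : X.IsSegalSpace]

/-- The morphism of `Ho X` given by an edge `p` of `X_{0, •}`: the component of the initial vertex
of any connection for `p`. -/
noncomputable def edgeHom {x y : (X _⦋0⦌) _⦋0⦌} (p : SSet.Edge x y) :
    Ho.of (X := X) x ⟶ Ho.of y :=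
  Ho.homMk (hX.isReedyFibrant.exists_isConnection p.edge).choose_spec.vertex

lemma IsConnection.edgeHom_eq {x y : (X _⦋0⦌) _⦋0⦌} {p : SSet.Edge x y} {σ : (X _⦋1⦌) _⦋1⦌}
    (h : X.IsConnection p.edge σ) : edgeHom p = Ho.homMk h.vertex :=
  IsConnection.mk_vertex_eq hX.isReedyFibrant _ h

lemma edgeHom_id (x : (X _⦋0⦌) _⦋0⦌) : edgeHom (SSet.Edge.id x) = 𝟙 (Ho.of (X := X) x) := by
  rw [(isConnection_id x).edgeHom_eq, isConnection_id_vertex]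
  rfl

lemma edgeHom_comp {x y z : (X _⦋0⦌) _⦋0⦌} {p : SSet.Edge x y}
    {q : SSet.Edge y z} {r : SSet.Edge x z} (t : SSet.Edge.CompStruct p q r) :
    edgeHom p ≫ edgeHom q = edgeHom r := by
  obtain ⟨σ, hσ⟩ := hX.isReedyFibrant.exists_isConnection p.edge
  obtain ⟨τ, hτ⟩ := hX.isReedyFibrant.exists_isConnection q.edge
  obtain ⟨T, hT₂, hT₀⟩ := exists_composite hσ.vertex hτ.vertex
  obtain ⟨ρ, hρ, hT₁⟩ := hσ.exists_comp t hτ T hT₂ hT₀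
  rw [hσ.edgeHom_eq, hτ.edgeHom_eq, hρ.edgeHom_eq, ← hT₂, ← hT₀, hT₁]
  exact comp_mk T

/-- The functor from the fundamental category of `X_{0, •}` to `Ho X` given by connections. -/
noncomputable def toHo (X : BisimplicialSet.{u}) [X.IsSegalSpace] :
    SSet.hoFunctor.obj (X _⦋0⦌) ⥤ Ho X :=
  SSet.Truncated.HomotopyCategory.lift (V := (truncation 2).obj (X _⦋0⦌)) Ho.of
    (fun p ↦ edgeHom (SSet.Edge.ofTruncated p)) edgeHom_id
    (fun t ↦ edgeHom_comp (SSet.Edge.CompStruct.ofTruncated t))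

lemma toHo_map {x y : (X _⦋0⦌) _⦋0⦌} (p : SSet.Edge x y) :
    X.toHo.map (SSet.Truncated.HomotopyCategory.homMk p.toTruncated) = edgeHom p :=
  SSet.Truncated.HomotopyCategory.lift_map_homMk (V := (truncation 2).obj (X _⦋0⦌)) Ho.of
    (fun p ↦ edgeHom (SSet.Edge.ofTruncated p)) edgeHom_id
    (fun t ↦ edgeHom_comp (SSet.Edge.CompStruct.ofTruncated t)) p.toTruncated

end SegalSpaces.BisimplicialSet

theorem mainTheorem7 (X : BisimplicialSet.{u}) [X.IsSegalSpace] :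
    (∀ p : (X _⦋0⦌) _⦋1⦌, ∃ σ : (X _⦋1⦌) _⦋1⦌, X.IsConnection p σ) ∧
    (∀ (p : (X _⦋0⦌) _⦋1⦌) (σ σ' : (X _⦋1⦌) _⦋1⦌),
      X.IsConnection p σ → X.IsConnection p σ' →
        SSet.π₀.mk ((X _⦋1⦌).δ 1 σ) = SSet.π₀.mk ((X _⦋1⦌).δ 1 σ')) ∧
    (∀ (x y : (X _⦋0⦌) _⦋0⦌) (p : SSet.Edge x y) (σ σ' : (X _⦋1⦌) _⦋1⦌)
      (h : X.IsConnection p.edge σ) (h' : X.IsConnection p.edge σ'),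
        SSet.π₀.mk h.vertex = SSet.π₀.mk h'.vertex) ∧
    ∃! j : SSet.hoFunctor.obj (X _⦋0⦌) ⥤ BisimplicialSet.Ho X,
      ∃ hobj : ∀ x : (X _⦋0⦌) _⦋0⦌,
          j.obj (SSet.Truncated.HomotopyCategory.mk x) = BisimplicialSet.Ho.of x,
        ∀ (x y : (X _⦋0⦌) _⦋0⦌) (p : SSet.Edge x y) (σ : (X _⦋1⦌) _⦋1⦌)
          (h : X.IsConnection p.edge σ),
          j.map (SSet.Truncated.HomotopyCategory.homMk p.toTruncated) =
            eqToHom (hobj x) ≫ BisimplicialSet.Ho.homMk h.vertex ≫ eqToHom (hobj y).symm := by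
  have hX := BisimplicialSet.IsSegalSpace.isReedyFibrant (X := X)
  refine ⟨hX.exists_isConnection, fun p σ σ' h h' ↦ ?_, fun x y p σ σ' h h' ↦
    h.mk_vertex_eq hX h', X.toHo, ⟨fun _ ↦ rfl, fun x y p σ h ↦ ?_⟩, ?_⟩
  · exact congr_arg (SSet.mapπ₀ (X.mapSpace ![_, _]).ι)
      (BisimplicialSet.IsConnection.mk_vertex_eq hX (p := SSet.Edge.mk' p) h h')
  · rw [BisimplicialSet.toHo_map, h.edgeHom_eq]
    exact ((Category.id_comp _).trans (Category.comp_id _)).symm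
  · rintro j ⟨hobj, hj⟩
    refine SSet.Truncated.HomotopyCategory.functor_ext
      (V := (SSet.truncation 2).obj (X _⦋0⦌)) hobj (fun x y e ↦ ?_)
    obtain ⟨σ, h⟩ := hX.exists_isConnection (SSet.Edge.ofTruncated e).edge
    refine (hj x y (SSet.Edge.ofTruncated e) σ h).trans ?_
    exact congr_arg (fun f ↦ eqToHom (hobj x) ≫ f ≫ eqToHom (hobj y).symm)
      (h.edgeHom_eq.symm.trans (BisimplicialSet.toHo_map (SSet.Edge.ofTruncated e)).symm)
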